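/- There are two tasks and two players. A bid is a vector $x=(x_1,x_2,x_{12})\in\mathbb R_{\ge 0}^3$ giving the costs of the bundles $1$, $2$, $12$ of tasks (the empty bundle costs $x_\emptyset=0$). Let $B>0$, $\epsilon>0$ and $$V=\{x: 0\le x_1,x_2\le x_{12}\},\quad V_{\mathrm{submod}}=\{x\in V: x_{12}\le x_1+x_2\},\quad V_\epsilon=\{x\in V: |x_{12}-x_1-x_2|<\epsilon\},$$ $$V_{+,B}=\{x: 0\le x_1,x_2<B,\ x_{12}=x_1+x_2\}.$$ Let $V^*\in\{V,V_{\mathrm{submod}},V_\epsilon,V_{\mathrm{submod}}\cap V_\epsilon\}$. Let $A$ be an allocation on $V^*\times V_{+,B}$ that always allocates both tasks: on bids $(t,s)$ the $t$-player receives the bundle $A(t,s)\in\{\emptyset,1,2,12\}$ and the $s$-player receives the complement $\overline{A(t,s)}$. Assume that $A$ is weakly monotone: for all $t,t'\in V^*$ and $s,s'\in V_{+,B}$, $$t(A(t,s))-t(A(t',s))\le t'(A(t,s))-t'(A(t',s)),$$ $$s(\overline{A(t,s)})-s(\overline{A(t,s')})\le s'(\overline{A(t,s)})-s'(\overline{A(t,s')}).$$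 Assume also that for every $s\in V_{+,B}$ the region $R_\emptyset(s)$, i.e. the interior relative to $V^*$ of $\{t\in V^*: A(t,s)=\emptyset\}$, is nonempty. Call a bid $x$ positive if $0<x_1<x_{12}$ and $0<x_2<x_{12}$ (for additive bids: $x_1,x_2>0$). Then, on the set of all pairs of positive bids $t\in V^*$, $s\in V_{+,B}$, the allocation $A$ is of at least one of the following types. Below, constants $\gamma=(\gamma_\emptyset,\gamma_1,\gamma_2,\gamma_{12})$ satisfy $\gamma_\emptyset\in\mathbb R$ and $\gamma_1,\gamma_2,\gamma_{12}\in\mathbb R\cup\{\infty\}$; "increasing" means non-decreasing; and where an increasing function $\xi$ has a jump at $x$, "critical value given by $\xi(x)$" means a critical value that may depend on $s$ but lies between $\xi(x^-)$ and $\xi(x^+)$. 1. A relaxed affine minimizer, that is, there are $\mu_t,\mu_s>0$ and $\gamma$ such that either * (affine minimizer) $A(t,s)$ always minimizes $\mu_t\, t_\alpha+\mu_s\, s_{\bar\alpha}+\gamma_\alpha$ over $\alpha\in\{\emptyset,1,2,12\}$; or * (affine minimizer with bundling tail) $D:=\min(\gamma_1,\gamma_2)-\gamma_\emptyset$ is finite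 and positive, and there is an increasing $\xi:[0,D]\to[0,\infty)$ with $\xi(D)=\min(\gamma_1,\gamma_2)-\gamma_{12}$, such that $A(t,s)$ minimizes the same objective whenever $\mu_s(s_1+s_2)>D$; and whenever $\mu_s(s_1+s_2)\le D$, the $t$-player receives $\emptyset$ or $12$, with critical value $c$ given by $\xi(\mu_s(s_1+s_2))$: he receives $\emptyset$ if $\mu_t t_{12}>c$ and $12$ if $\mu_t t_{12}<c$ (at $D$ we put $\xi(D^+)=\xi(D)$). 2. A one-dimensional mechanism: for some bundle $\alpha\in\{1,2,12\}$ the $t$-player only ever receives $\emptyset$ or $\alpha$, and there is an increasing nonnegative function $\xi$ of $s_\alpha$ such that, with critical value $c$ given by $\xi(s_\alpha)$, he receives $\emptyset$ if $t_\alpha>c$ and $\alpha$ if $t_\alpha<c$ (for $\alpha=12$: a bundling mechanism). 3. A constant mechanism: up to tie-breaking the allocation does not depend on $s$, i.e. there are $\mu_t>0$ and $\gamma$ such that $A(t,s)$ always minimizes $\mu_t t_\alpha+\gamma_\alpha$ over $\alpha\in\{\emptyset,1,2,12\}$. -/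

import Mathlib

open Set Topology

/-- The four bundles of the two tasks. -/
inductive Bundle
  | empty
  | one
  | two
  | both

/-- The tasks that are not in the bundle. -/
def Bundle.compl : Bundle → Bundle
  | .empty => .both
  | .one => .two
  | .two => .one
  | .both => .empty

/-- A bid is a vector `(x₁, x₂, x₁₂)`. -/
abbrev Bid : Type := ℝ × ℝ × ℝ

/-- The cost of a bundle under the bid `(x₁, x₂, x₁₂)`; the empty bundle costs `0`. -/
def cost (x : Bid) : Bundle → ℝ
  | .empty => 0
  | .one => x.1
  | .two => x.2.1
  | .both => x.2.2

/-- All monotone valuations. -/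
def monotoneVals : Set Bid :=
  {x | 0 ≤ x.1 ∧ 0 ≤ x.2.1 ∧ x.1 ≤ x.2.2 ∧ x.2.1 ≤ x.2.2}

/-- All submodular (for two tasks: subadditive) monotone valuations. -/
def submodVals : Set Bid :=
  {x | x ∈ monotoneVals ∧ x.2.2 ≤ x.1 + x.2.1}

/-- All `ε`-additive monotone valuations. -/
def epsAddVals (ε : ℝ) : Set Bid :=
  {x | x ∈ monotoneVals ∧ x.2.2 ∈ Ioo (x.1 + x.2.1 - ε) (x.1 + x.2.1 + ε)}

/-- All additive valuations with both single-task costs in `[0, B)`. -/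
def boundedAddVals (B : ℝ) : Set Bid :=
  {x | x.1 ∈ Ico 0 B ∧ x.2.1 ∈ Ico 0 B ∧ x.2.2 = x.1 + x.2.1}

/-- The valuations in `D` for which every task has positive marginal cost:
`0 < x₁ < x₁₂` and `0 < x₂ < x₁₂`. For an additive valuation this says `x₁ > 0` and `x₂ > 0`. -/
def positivePart (D : Set Bid) : Set Bid :=
  {x | x ∈ D ∧ 0 < x.1 ∧ 0 < x.2.1 ∧ x.1 < x.2.2 ∧ x.2.1 < x.2.2}

/-- An allocation in which both tasks are always allocated: `A t s` is the bundle of the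
`t`-player, and the `s`-player receives `(A t s).compl`. Only its values on the domain under
consideration matter. -/
abbrev Allocation : Type := Bid → Bid → Bundle

/-- Weak monotonicity, for both players, on the domain `T × S`. -/
def IsWMON (T S : Set Bid) (A : Allocation) : Prop :=
  (∀ s ∈ S, ∀ t ∈ T, ∀ t' ∈ T,
    cost t (A t s) - cost t (A t' s) ≤ cost t' (A t s) - cost t' (A t' s)) ∧
  (∀ t ∈ T, ∀ s ∈ S, ∀ s' ∈ S,
    cost s (A t s).compl - cost s (A t s').compl ≤
      cost s' (A t s).compl - cost s' (A t s').compl)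

/-- The region `R_α(s)`: the interior, relative to `T`, of the set of all `t ∈ T` for which the
`t`-player receives `α`. -/
def region (T : Set Bid) (A : Allocation) (α : Bundle) (s : Bid) : Set Bid :=
  {t | t ∈ T ∧ ∀ᶠ t' in 𝓝[T] t, A t' s = α}

/-- Admissible additive constants of an affine minimizer. The constant of the empty bundle is
finite and no constant is `-∞`: otherwise the `t`-player could never receive the empty bundle, or
the minimization would be between equal infinite values. -/
def AdmissibleConstants (γ : Bundle → EReal) : Prop :=
  γ .empty ≠ ⊤ ∧ ∀ α, γ α ≠ ⊥

/-- The objective `μₜ t(α) + μₛ s(αᶜ) + γ_α`. -/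
noncomputable def affineCost (μt μs : ℝ) (γ : Bundle → EReal) (t s : Bid) (α : Bundle) : EReal :=
  ((μt * cost t α + μs * cost s α.compl : ℝ) : EReal) + γ α

/-- `α` minimizes the objective (ties are broken arbitrarily). -/
def MinimizesAffineCost (μt μs : ℝ) (γ : Bundle → EReal) (t s : Bid) (α : Bundle) : Prop :=
  ∀ β, affineCost μt μs γ t s α ≤ affineCost μt μs γ t s β

/-- Affine minimizers on `T × S`. -/
def IsAffineMinimizer (T S : Set Bid) (A : Allocation) : Prop :=
  ∃ (μt μs : ℝ) (γ : Bundle → EReal), 0 < μt ∧ 0 < μs ∧ AdmissibleConstants γ ∧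
    ∀ t ∈ T, ∀ s ∈ S, MinimizesAffineCost μt μs γ t s (A t s)

/-- For `ξ` increasing on `I`: the number `c` lies between the one-sided limits `ξ(x⁻)` and
`ξ(x⁺)`. So `c = ξ x` where `ξ` is continuous, and `c` has some freedom where `ξ` jumps. -/
def BetweenLimits (ξ : ℝ → ℝ) (I : Set ℝ) (x c : ℝ) : Prop :=
  (∀ y ∈ I, y < x → ξ y ≤ c) ∧ (∀ y ∈ I, x < y → c ≤ ξ y)

/-- For this `s`, only `∅` and `α` are allocated to the `t`-player, with critical value `c` for
`μ * t(α)`. -/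
def HasCriticalValue (T : Set Bid) (A : Allocation) (α : Bundle) (μ : ℝ) (s : Bid) (c : ℝ) :
    Prop :=
  ∀ t ∈ T, (A t s = .empty ∨ A t s = α) ∧
    (c < μ * cost t α → A t s = .empty) ∧ (μ * cost t α < c → A t s = α)

/-- Relaxed affine minimizers with a bundling tail on the nonempty interval `[0, D)`, where
`D = min(γ₁, γ₂) - γ_∅`. On the tail the critical value for `μₜ t₁₂` is given by an increasing
function `ξ` of `μₛ (s₁ + s₂)` with `ξ(D) = min(γ₁, γ₂) - γ₁₂`. Where `ξ` jumps (possibly at the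
end `D` of the tail, where `ξ(D)` is the upper limit), the critical value may depend on `s`. -/
def IsAffineMinimizerWithTail (T S : Set Bid) (A : Allocation) : Prop :=
  ∃ (μt μs : ℝ) (γ : Bundle → EReal) (D : ℝ) (ξ : ℝ → ℝ),
    0 < μt ∧ 0 < μs ∧ AdmissibleConstants γ ∧
    0 < D ∧ (D : EReal) = min (γ .one) (γ .two) - γ .empty ∧
    MonotoneOn ξ (Icc 0 D) ∧ (∀ x ∈ Icc 0 D, 0 ≤ ξ x) ∧
    ((ξ D : ℝ) : EReal) = min (γ .one) (γ .two) - γ .both ∧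
    (∀ s ∈ S, D < μs * (s.1 + s.2.1) →
      ∀ t ∈ T, MinimizesAffineCost μt μs γ t s (A t s)) ∧
    (∀ s ∈ S, μs * (s.1 + s.2.1) ≤ D →
      ∃ c, BetweenLimits ξ (Icc 0 D) (μs * (s.1 + s.2.1)) c ∧ c ≤ ξ D ∧
        HasCriticalValue T A .both μt s c)

/-- Relaxed affine minimizers: affine minimizers, possibly with a bundling tail. -/
def IsRelaxedAffineMinimizer (T S : Set Bid) (A : Allocation) : Prop :=
  IsAffineMinimizer T S A ∨ IsAffineMinimizerWithTail T S A

/-- One-dimensional mechanisms: the `t`-player only ever receives `∅` or one fixed bundle `α`, and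
the critical value for `t(α)` is given by an increasing nonnegative function `ξ` of `s(α)`; where
`ξ` jumps, the critical value may depend on `s`. For `α = {1, 2}` these are the bundling
mechanisms. -/
def IsOneDimensional (T S : Set Bid) (A : Allocation) : Prop :=
  ∃ (α : Bundle) (ξ : ℝ → ℝ), α ≠ .empty ∧
    MonotoneOn ξ ((fun s => cost s α) '' S) ∧
    (∀ x ∈ (fun s => cost s α) '' S, 0 ≤ ξ x) ∧
    ∀ s ∈ S, ∃ c, BetweenLimits ξ ((fun s => cost s α) '' S) (cost s α) c ∧
      HasCriticalValue T A α 1 s c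

/-- Constant mechanisms: up to the breaking of ties, the allocation does not depend on the bid of
the `s`-player, that is, it is an affine minimizer with multiplicative constant `0` for the
`s`-player. -/
def IsConstantMechanism (T S : Set Bid) (A : Allocation) : Prop :=
  ∃ (μt : ℝ) (γ : Bundle → EReal), 0 < μt ∧ AdmissibleConstants γ ∧
    ∀ t ∈ T, ∀ s ∈ S, MinimizesAffineCost μt 0 γ t s (A t s)

/-!
Fix a bid `s` of the other player. Weak monotonicity of the `t`-player, together with a bid that
receives `∅`, yields prices `f₁`, `f₂`, `f₁₂` such that the bundle given to any `t` minimizes cost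
minus price. Conversely, near the prices there are bids `t` at which `s` and `s'` lead to two
prescribed bundles. Hence weak monotonicity of the `s`-player makes `f₁` and `f₁₂ - f₂` monotone in
`x`, `f₂` and `f₁₂ - f₁` monotone in `y`, `f₁₂` monotone in `x + y`, and `f₁ - f₂` monotone in
`x - y`, where `s = (x, y, x + y)`, as long as the bundles in question are received by some bid.

Being monotone in `x` whatever `y` does, `f₁` depends on `x` alone up to its jumps, and likewise
`f₂` on `y`. If `f₁₂ < f₁ + f₂` on some rectangle, then monotonicity of `f₁ - f₂` in `x - y` lets
the increments of `f₁` and `f₂` bound each other. A monotone function is differentiable somewhere,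
and its derivative there becomes the slope of both functions everywhere on the rectangle; from there
the affine formulas spread to all bids. If there is no such rectangle, the same comparison of
increments applies to `f₂` and the marginal price `f₁₂ - f₂`, whose sum is monotone in `x + y`. This
determines the prices except where `f₁ = f₂ = 0`: there `f₁₂` may be any increasing function of
`x + y`, which is the bundling tail.
-/

theorem le_of_forall_mem_Ioo_right {g : ℝ → ℝ} {w x b : ℝ} (hx : x < b)
    (h : ∀ z ∈ Ioo x b, w ≤ g z) (hg : Continuous g := by fun_prop) : w ≤ g x :=
  ge_of_tendsto (hg.continuousWithinAt (s := Ioi x))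
    (Filter.mem_of_superset (Ioo_mem_nhdsGT hx) h)

theorem le_of_forall_mem_Ioo_left {g : ℝ → ℝ} {w a x : ℝ} (hx : a < x)
    (h : ∀ z ∈ Ioo a x, g z ≤ w) (hg : Continuous g := by fun_prop) : g x ≤ w :=
  le_of_tendsto (hg.continuousWithinAt (s := Iio x))
    (Filter.mem_of_superset (Ioo_mem_nhdsLT hx) h)

theorem eq_of_forall_mem_Ioo {g : ℝ → ℝ} {w a x b : ℝ} (hx : x ∈ Ioo a b)
    (hl : ∀ z ∈ Ioo a b, z < x → g z ≤ w) (hr : ∀ z ∈ Ioo a b, x < z → w ≤ g z)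
    (hg : Continuous g := by fun_prop) : w = g x :=
  le_antisymm
    (le_of_forall_mem_Ioo_right hx.2 (fun z hz => hr z ⟨hx.1.trans hz.1, hz.2⟩ hz.1) hg)
    (le_of_forall_mem_Ioo_left hx.1 (fun z hz => hl z ⟨hz.1, hz.2.trans hx.2⟩ hz.2) hg)

theorem affine_unique {l c l' c' a b : ℝ} (hab : a < b)
    (h : ∀ x ∈ Ioo a b, l * x + c = l' * x + c') : l = l' ∧ c = c' := by
  obtain ⟨x, hax, hxb⟩ := exists_between hab
  obtain ⟨y, hxy, hyb⟩ := exists_between hxb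
  have hx := h x ⟨hax, hxb⟩
  have hy := h y ⟨hax.trans hxy, hyb⟩
  have hl : l = l' := mul_right_cancel₀ (sub_pos.2 hxy).ne' (by linarith)
  subst hl
  exact ⟨rfl, by linarith⟩

theorem exists_pos_lt_mul_lt {l m e : ℝ} (hl : 0 ≤ l) (hm : 0 < m) (he : 0 < e) :
    ∃ h, 0 < h ∧ h < m ∧ l * h < e := by
  obtain ⟨h, h_pos, hh⟩ := exists_between (lt_min hm (show 0 < e / (l + 1) by positivity))
  refine ⟨h, h_pos, hh.trans_le (min_le_left _ _), ?_⟩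
  have : h * (l + 1) < e := (lt_div_iff₀ (by positivity)).1 (hh.trans_le (min_le_right _ _))
  linarith

theorem eq_affine_of_forall_slope_sub_le {a b l : ℝ} {θ : ℝ → ℝ}
    (h : ∀ η > 0, ∃ δ > 0, ∀ y ∈ Ioo a b, ∀ y' ∈ Ioo a b, y < y' → y' - y < δ →
      |θ y' - θ y - l * (y' - y)| ≤ η * (y' - y)) :
    ∃ c, ∀ y ∈ Ioo a b, θ y = l * y + c := by
  have hasDeriv_zero : ∀ y ∈ Ioo a b, HasDerivAt (fun z => θ z - l * z) 0 y := by
    intro y hy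
    rw [hasDerivAt_iff_isLittleO, Asymptotics.isLittleO_iff]
    intro η hη
    obtain ⟨δ, hδ, hθ⟩ := h η hη
    filter_upwards [Ioo_mem_nhds hy.1 hy.2,
      Ioo_mem_nhds (sub_lt_self y hδ) (lt_add_of_pos_right y hδ)] with z hz hzδ
    simp only [smul_zero, sub_zero, Real.norm_eq_abs]
    rcases lt_trichotomy y z with hyz | rfl | hyz
    · rw [abs_of_pos (sub_pos.2 hyz)]
      convert hθ y hy z hz hyz (by linarith [hzδ.2]) using 2
      ring
    · simp
    · rw [abs_sub_comm z y, abs_of_pos (sub_pos.2 hyz), abs_sub_comm]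
      convert hθ z hz y hy hyz (by linarith [hzδ.1]) using 2
      ring
  obtain ⟨c, hc⟩ := isOpen_Ioo.exists_is_const_of_deriv_eq_zero isPreconnected_Ioo
    (fun y hy => (hasDeriv_zero y hy).differentiableAt.differentiableWithinAt)
    (fun y hy => (hasDeriv_zero y hy).deriv)
  exact ⟨c, fun y hy => by linarith [hc y hy]⟩

theorem exists_hasDerivAt_of_monotoneOn {a b : ℝ} (hab : a < b) {φ : ℝ → ℝ}
    (hφ : MonotoneOn φ (Ioo a b)) : ∃ x ∈ Ioo a b, ∃ l, HasDerivAt φ l x := by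
  have h := hφ.ae_differentiableWithinAt measurableSet_Ioo
  have : (MeasureTheory.ae (MeasureTheory.volume.restrict (Ioo a b))).NeBot := by
    rw [MeasureTheory.ae_neBot, Ne, MeasureTheory.Measure.restrict_eq_zero]
    simp [hab]
  obtain ⟨x, hφx, hx⟩ := (h.and (MeasureTheory.ae_restrict_mem measurableSet_Ioo)).exists
  exact ⟨x, hx, _, (hφx.differentiableAt (isOpen_Ioo.mem_nhds hx)).hasDerivAt⟩

theorem exists_increment_bound_of_hasDerivAt {a b l x κ η : ℝ} {φ : ℝ → ℝ} (hx : x ∈ Ioo a b)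
    (hφ : HasDerivAt φ l x) (hκ : 0 < κ) (hη : 0 < η) :
    ∃ δ > 0, ∀ h ∈ Ioo 0 δ, x + h ∈ Ioo a b ∧ φ (x + h) - φ x < κ ∧
      |φ (x + h) - φ x - l * h| ≤ η * h := by
  have hmem : ∀ᶠ z in 𝓝 x, z ∈ Ioo a b := isOpen_Ioo.mem_nhds hx
  have hlt : ∀ᶠ z in 𝓝 x, φ z < φ x + κ :=
    hφ.continuousAt.eventually_lt_const (lt_add_of_pos_right _ hκ)
  rw [hasDerivAt_iff_isLittleO, Asymptotics.isLittleO_iff] at hφ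
  obtain ⟨δ, hδ, H⟩ := Metric.eventually_nhds_iff.1 ((hmem.and hlt).and (hφ hη))
  refine ⟨δ, hδ, fun h hh => ?_⟩
  obtain ⟨⟨hmem, hlt⟩, hle⟩ := H (y := x + h) (by simpa [abs_of_pos hh.1] using hh.2)
  simp only [add_sub_cancel_left, smul_eq_mul, Real.norm_eq_abs, abs_of_pos hh.1] at hle
  exact ⟨hmem, by linarith, by rwa [mul_comm l h]⟩

/-- Over a shorter interval, `φ` increases by at most as much as `ψ` does over a longer one, as long
as the latter increment is below `κ`. -/
def IncrementsLE (κ : ℝ) (I J : Set ℝ) (φ ψ : ℝ → ℝ) : Prop :=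
  ∀ x ∈ I, ∀ x' ∈ I, ∀ y ∈ J, ∀ y' ∈ J, x < x' → x' - x < y' - y →
    ψ y' - ψ y < κ → φ x' - φ x ≤ ψ y' - ψ y

theorem exists_eq_affine_of_hasDerivAt {a b c d κ l x : ℝ} {φ ψ : ℝ → ℝ} (hκ : 0 < κ)
    (hφψ : IncrementsLE κ (Ioo a b) (Ioo c d) φ ψ) (hψφ : IncrementsLE κ (Ioo c d) (Ioo a b) ψ φ)
    (hx : x ∈ Ioo a b) (hφ : HasDerivAt φ l x) : ∃ c₂, ∀ y ∈ Ioo c d, ψ y = l * y + c₂ := by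
  refine eq_affine_of_forall_slope_sub_le fun η hη => ?_
  obtain ⟨δ, hδ, bound⟩ := exists_increment_bound_of_hasDerivAt hx hφ hκ hη
  refine ⟨δ, hδ, fun y hy y' hy' hyy' hlt => ?_⟩
  have le_increment : ∀ h ∈ Ioo (y' - y) δ, ψ y' - ψ y ≤ φ (x + h) - φ x := by
    intro h hh
    obtain ⟨hmem, hsmall, -⟩ := bound h ⟨by linarith [hh.1], hh.2⟩
    exact hψφ y hy y' hy' x hx _ hmem hyy' (by linarith [hh.1]) hsmall
  have lt_κ : ψ y' - ψ y < κ := by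
    obtain ⟨h, hh⟩ := exists_between hlt
    exact (le_increment h hh).trans_lt (bound h ⟨by linarith [hh.1], hh.2⟩).2.1
  have upper : ψ y' - ψ y ≤ (l + η) * (y' - y) := by
    refine le_of_forall_mem_Ioo_right (g := fun h => (l + η) * h) hlt fun h hh => ?_
    have hle := (abs_le.1 (bound h ⟨by linarith [hh.1], hh.2⟩).2.2).2
    linarith [le_increment h hh]
  have lower : (l - η) * (y' - y) ≤ ψ y' - ψ y := by
    refine le_of_forall_mem_Ioo_left (g := fun h => (l - η) * h) (sub_pos.2 hyy') fun h hh => ?_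
    obtain ⟨hmem, -, habs⟩ := bound h ⟨hh.1, hh.2.trans hlt⟩
    have hle := hφψ x hx _ hmem y hy y' hy' (by linarith [hh.1]) (by linarith [hh.2]) lt_κ
    linarith [(abs_le.1 habs).1]
  rw [abs_le]
  constructor <;> linarith

theorem exists_common_slope {a b c d κ : ℝ} (hab : a < b) (hcd : c < d) (hκ : 0 < κ)
    {φ ψ : ℝ → ℝ} (hφ : MonotoneOn φ (Ioo a b))
    (hφψ : IncrementsLE κ (Ioo a b) (Ioo c d) φ ψ)
    (hψφ : IncrementsLE κ (Ioo c d) (Ioo a b) ψ φ) :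
    ∃ l : ℝ, 0 ≤ l ∧ ∃ c₁ c₂, (∀ x ∈ Ioo a b, φ x = l * x + c₁) ∧
      ∀ y ∈ Ioo c d, ψ y = l * y + c₂ := by
  obtain ⟨x, hx, l, hl⟩ := exists_hasDerivAt_of_monotoneOn hab hφ
  obtain ⟨c₂, hψ_eq⟩ := exists_eq_affine_of_hasDerivAt hκ hφψ hψφ hx hl
  obtain ⟨y, hy⟩ := exists_between hcd
  have hψ_deriv : HasDerivAt ψ l y := by
    have h := ((hasDerivAt_id y).const_mul l).add_const c₂
    rw [mul_one] at h
    exact h.congr_of_eventuallyEq (Filter.mem_of_superset (isOpen_Ioo.mem_nhds hy) hψ_eq)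
  obtain ⟨c₁, hφ_eq⟩ := exists_eq_affine_of_hasDerivAt hκ hψφ hφψ hy hψ_deriv
  refine ⟨l, ?_, c₁, c₂, hφ_eq, hψ_eq⟩
  obtain ⟨x', hxx', hx'b⟩ := exists_between hx.2
  have hx' : x' ∈ Ioo a b := ⟨hx.1.trans hxx', hx'b⟩
  have hle := hφ hx hx' hxx'.le
  rw [hφ_eq x hx, hφ_eq x' hx'] at hle
  exact nonneg_of_mul_nonneg_left (by linarith : 0 ≤ l * (x' - x)) (sub_pos.2 hxx')

theorem exists_mem_Ioo_of_subset_closure {I J : Set ℝ} {G : Set (ℝ × ℝ)}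
    (hG : I ×ˢ J ⊆ closure G) {p q r s : ℝ} (hpq : p < q) (hrs : r < s) (hI : Ioo p q ⊆ I)
    (hJ : Ioo r s ⊆ J) : ∃ x ∈ Ioo p q, ∃ y ∈ Ioo r s, (x, y) ∈ G := by
  obtain ⟨x, hx⟩ := exists_between hpq
  obtain ⟨y, hy⟩ := exists_between hrs
  obtain ⟨P, ⟨hPx, hPy⟩, hP⟩ := mem_closure_iff.1 (hG (mk_mem_prod (hI hx) (hJ hy)))
    (Ioo p q ×ˢ Ioo r s) (isOpen_Ioo.prod isOpen_Ioo) (mk_mem_prod hx hy)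
  exact ⟨P.1, hPx, P.2, hPy, hP⟩

theorem exists_threshold {a b : ℝ} {J : Set ℝ} {P : ℝ → ℝ → Prop}
    (hP : ∀ x ∈ Ioo a b, ∀ y ∈ J, ∀ x' ∈ Ioo a b, ∀ y' ∈ J, x < x' → P x y → P x' y')
    (hne : ∃ x ∈ Ioo a b, ∃ y ∈ J, P x y) :
    ∃ p ∈ Ico a b, ∀ x ∈ Ioo a b, ∀ y ∈ J, (x < p → ¬P x y) ∧ (p < x → P x y) := by
  set S : Set ℝ := {x | x ∈ Ioo a b ∧ ∃ y ∈ J, P x y}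
  have hbdd : a ∈ lowerBounds S := fun x hx => hx.1.1.le
  obtain ⟨x₀, hx₀, hPx₀⟩ := hne
  have hx₀S : x₀ ∈ S := ⟨hx₀, hPx₀⟩
  refine ⟨sInf S, ⟨le_csInf ⟨x₀, hx₀S⟩ hbdd, (csInf_le ⟨a, hbdd⟩ hx₀S).trans_lt hx₀.2⟩,
    fun x hx y hy => ⟨fun hlt hPx => ?_, fun hlt => ?_⟩⟩
  · exact hlt.not_ge (csInf_le ⟨a, hbdd⟩ ⟨hx, y, hy, hPx⟩)
  · obtain ⟨z, ⟨hz, w, hw, hPz⟩, hzx⟩ := exists_lt_of_csInf_lt ⟨x₀, hx₀S⟩ hlt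
    exact hP z hz w hw x hx y hy hzx hPz

/-- The setting of the comparison principle on the rectangle `(a, b) × (c, d)`: `u` depends
essentially on the first coordinate and `v` on the second, and `u + v` is, up to small increments
and at the points of a dense set `G`, an increasing function of `x + y`. -/
structure IsComparable (κ a b c d : ℝ) (u v : ℝ → ℝ → ℝ) (G : Set (ℝ × ℝ)) : Prop where
  lt₁ : a < b
  lt₂ : c < d
  κ_pos : 0 < κ
  mono₁ : ∀ x ∈ Ioo a b, ∀ y ∈ Ioo c d, ∀ x' ∈ Ioo a b, ∀ y' ∈ Ioo c d,
    x < x' → u x y ≤ u x' y'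
  mono₂ : ∀ x ∈ Ioo a b, ∀ y ∈ Ioo c d, ∀ x' ∈ Ioo a b, ∀ y' ∈ Ioo c d,
    y < y' → v x y ≤ v x' y'
  subset_closure : Ioo a b ×ˢ Ioo c d ⊆ closure G
  add_le_add : ∀ x ∈ Ioo a b, ∀ y ∈ Ioo c d, ∀ x' ∈ Ioo a b, ∀ y' ∈ Ioo c d,
    (x, y) ∈ G → (x', y') ∈ G → x + y < x' + y' → 0 < u x y →
    u x' y' - u x y < κ → v x' y' - v x y < min κ (u x y) → u x y + v x y ≤ u x' y' + v x' y'

namespace IsComparable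

variable {κ a b c d : ℝ} {u v : ℝ → ℝ → ℝ} {G : Set (ℝ × ℝ)}

theorem of_le_left (h : IsComparable κ a b c d u v G) {a' : ℝ} (ha : a ≤ a') (hb : a' < b) :
    IsComparable κ a' b c d u v G := by
  have hsub : ∀ x ∈ Ioo a' b, x ∈ Ioo a b := Ioo_subset_Ioo_left ha
  exact
    { lt₁ := hb
      lt₂ := h.lt₂
      κ_pos := h.κ_pos
      mono₁ := fun x hx y hy x' hx' => h.mono₁ x (hsub x hx) y hy x' (hsub x' hx')
      mono₂ := fun x hx y hy x' hx' => h.mono₂ x (hsub x hx) y hy x' (hsub x' hx')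
      subset_closure := (prod_mono_left hsub).trans h.subset_closure
      add_le_add := fun x hx y hy x' hx' => h.add_le_add x (hsub x hx) y hy x' (hsub x' hx') }

theorem add_le_add_of_increments_lt (h : IsComparable κ a b c d u v G) {m : ℝ} (hm : 0 < m)
    (hmκ : m ≤ κ) (hu : ∀ x ∈ Ioo a b, ∀ y ∈ Ioo c d, m ≤ u x y) {x₀ y₀ x y x' y' : ℝ}
    (hx₀ : x₀ ∈ Ioo a b) (hy₀ : y₀ ∈ Ioo c d) (hx : x ∈ Ioo a b) (hy : y ∈ Ioo c d)
    (hx' : x' ∈ Ioo a b) (hy' : y' ∈ Ioo c d) (hlt : x + y < x' + y')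
    (hum : u x' y₀ - u x y₀ < m) (hvm : v x₀ y' - v x₀ y < m) :
    u x y₀ + v x₀ y ≤ u x' y₀ + v x₀ y' := by
  set e := (x' + y' - (x + y)) / 4 with he
  have he_pos : 0 < e := by linarith
  obtain ⟨p, ⟨hxp, hpb⟩, q, ⟨hyq, hqd⟩, hpq⟩ := exists_mem_Ioo_of_subset_closure h.subset_closure
    (lt_min hx.2 (lt_add_of_pos_right x he_pos)) (lt_min hy.2 (lt_add_of_pos_right y he_pos))
    (Ioo_subset_Ioo hx.1.le (min_le_left _ _)) (Ioo_subset_Ioo hy.1.le (min_le_left _ _))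
  obtain ⟨p', ⟨hap', hpx'⟩, q', ⟨hcq', hqy'⟩, hpq'⟩ := exists_mem_Ioo_of_subset_closure
    h.subset_closure (max_lt hx'.1 (sub_lt_self x' he_pos)) (max_lt hy'.1 (sub_lt_self y' he_pos))
    (Ioo_subset_Ioo (le_max_left _ _) hx'.2.le) (Ioo_subset_Ioo (le_max_left _ _) hy'.2.le)
  rw [lt_min_iff] at hpb hqd
  rw [max_lt_iff] at hap' hcq'
  have hp : p ∈ Ioo a b := ⟨hx.1.trans hxp, hpb.1⟩
  have hq : q ∈ Ioo c d := ⟨hy.1.trans hyq, hqd.1⟩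
  have hp' : p' ∈ Ioo a b := ⟨hap'.1, hpx'.trans hx'.2⟩
  have hq' : q' ∈ Ioo c d := ⟨hcq'.1, hqy'.trans hy'.2⟩
  have hup := h.mono₁ x hx y₀ hy₀ p hp q hq hxp
  have hup' := h.mono₁ p' hp' q' hq' x' hx' y₀ hy₀ hpx'
  have hvq := h.mono₂ x₀ hx₀ y hy p hp q hq hyq
  have hvq' := h.mono₂ p' hp' q' hq' x₀ hx₀ y' hy' hqy'
  have hmu := hu p hp q hq
  have := h.add_le_add p hp q hq p' hp' q' hq' hpq hpq' (by linarith) (by linarith) (by linarith)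
    (lt_min (by linarith) (by linarith))
  linarith

theorem exists_eq_affine_of_le (h : IsComparable κ a b c d u v G) {m : ℝ} (hm : 0 < m)
    (hu : ∀ x ∈ Ioo a b, ∀ y ∈ Ioo c d, m ≤ u x y) :
    ∃ l : ℝ, 0 ≤ l ∧ ∃ c₁ c₂, ∀ x ∈ Ioo a b, ∀ y ∈ Ioo c d,
      u x y = l * x + c₁ ∧ v x y = l * y + c₂ := by
  obtain ⟨x₀, hx₀⟩ := exists_between h.lt₁
  obtain ⟨y₀, hy₀⟩ := exists_between h.lt₂
  have hm' : 0 < min κ m := lt_min h.κ_pos hm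
  have hu' : ∀ x ∈ Ioo a b, ∀ y ∈ Ioo c d, min κ m ≤ u x y :=
    fun x hx y hy => (min_le_right κ m).trans (hu x hx y hy)
  have hu_mono : MonotoneOn (fun x => u x y₀) (Ioo a b) := by
    intro x hx x' hx' hxx'
    rcases hxx'.eq_or_lt with rfl | hlt
    · exact le_rfl
    · exact h.mono₁ x hx y₀ hy₀ x' hx' y₀ hy₀ hlt
  obtain ⟨l, hl, c₁, c₂, hu_eq, hv_eq⟩ := exists_common_slope (φ := fun x => u x y₀)
    (ψ := fun y => v x₀ y) h.lt₁ h.lt₂ hm' hu_mono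
    (fun x hx x' hx' y hy y' hy' hxx' hlt hκ => by
      linarith [h.add_le_add_of_increments_lt hm' (min_le_left κ m) hu' hx₀ hy₀ hx' hy hx hy'
        (by linarith) (by linarith [h.mono₁ x hx y₀ hy₀ x' hx' y₀ hy₀ hxx']) hκ])
    (fun y hy y' hy' x hx x' hx' hyy' hlt hκ => by
      linarith [h.add_le_add_of_increments_lt hm' (min_le_left κ m) hu' hx₀ hy₀ hx hy' hx' hy
        (by linarith) hκ
        (by linarith [h.mono₂ x₀ hx₀ y hy x₀ hx₀ y' hy' hyy'])])
  refine ⟨l, hl, c₁, c₂, fun x hx y hy => ⟨?_, ?_⟩⟩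
  · refine eq_of_forall_mem_Ioo (g := fun z => l * z + c₁) hx (fun z hz hzx => ?_)
      (fun z hz hxz => ?_)
    · exact hu_eq z hz ▸ h.mono₁ z hz y₀ hy₀ x hx y hy hzx
    · exact hu_eq z hz ▸ h.mono₁ x hx y hy z hz y₀ hy₀ hxz
  · refine eq_of_forall_mem_Ioo (g := fun z => l * z + c₂) hy (fun z hz hzy => ?_)
      (fun z hz hyz => ?_)
    · exact hv_eq z hz ▸ h.mono₂ x₀ hx₀ z hz x hx y hy hzy
    · exact hv_eq z hz ▸ h.mono₂ x hx y hy x₀ hx₀ z hz hyz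

theorem exists_eq_affine_of_pos (h : IsComparable κ a b c d u v G) {p : ℝ} (hp : p ∈ Ico a b)
    (hpos : ∀ x ∈ Ioo a b, ∀ y ∈ Ioo c d, p < x → 0 < u x y) :
    ∃ l : ℝ, 0 ≤ l ∧ ∃ c₁ c₂, (∀ x ∈ Ioo a b, ∀ y ∈ Ioo c d, p < x → u x y = l * x + c₁) ∧
      ∀ x ∈ Ioo a b, ∀ y ∈ Ioo c d, v x y = l * y + c₂ := by
  obtain ⟨y₀, hy₀⟩ := exists_between h.lt₂
  have right_of : ∀ x ∈ Ioo p b, ∃ l : ℝ, 0 ≤ l ∧ ∃ c₁ c₂, ∀ x' ∈ Ioo x b, ∀ y ∈ Ioo c d,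
      u x' y = l * x' + c₁ ∧ v x' y = l * y + c₂ := by
    intro x hx
    have hxab : x ∈ Ioo a b := ⟨hp.1.trans_lt hx.1, hx.2⟩
    refine (h.of_le_left hxab.1.le hx.2).exists_eq_affine_of_le (hpos x hxab y₀ hy₀ hx.1) ?_
    exact fun x' hx' y hy =>
      h.mono₁ x hxab y₀ hy₀ x' ⟨hxab.1.trans hx'.1, hx'.2⟩ y hy hx'.1
  obtain ⟨x₀, hx₀⟩ := exists_between hp.2
  obtain ⟨x₁, hx₁⟩ := exists_between hx₀.2
  have hx₁ab : x₁ ∈ Ioo a b := ⟨hp.1.trans_lt (hx₀.1.trans hx₁.1), hx₁.2⟩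
  obtain ⟨l, hl, c₁, c₂, huv⟩ := right_of x₀ hx₀
  refine ⟨l, hl, c₁, c₂, fun x hx y hy hpx => ?_, fun x hx y hy => ?_⟩
  · obtain ⟨x₂, hpx₂, hx₂⟩ := exists_between (lt_min hpx hx₀.1)
    rw [lt_min_iff] at hx₂
    obtain ⟨l', -, c₁', c₂', huv'⟩ := right_of x₂ ⟨hpx₂, hx₂.1.trans hx.2⟩
    have hx₁' : x₁ ∈ Ioo x₂ b := ⟨hx₂.2.trans hx₁.1, hx₁.2⟩
    have hl' : l = l' := (affine_unique h.lt₂ fun y hy => by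
      rw [← (huv x₁ hx₁ y hy).2, (huv' x₁ hx₁' y hy).2]).1
    have hc₁ : l * x₁ + c₁ = l' * x₁ + c₁' := by
      rw [← (huv x₁ hx₁ y hy).1, (huv' x₁ hx₁' y hy).1]
    rw [(huv' x ⟨hx₂.1, hx.2⟩ y hy).1, ← hl']
    rw [← hl'] at hc₁
    linarith
  · refine eq_of_forall_mem_Ioo (g := fun z => l * z + c₂) hy (fun z hz hzy => ?_)
      (fun z hz hyz => ?_)
    · exact (huv x₁ hx₁ z hz).2 ▸ h.mono₂ x₁ hx₁ab z hz x hx y hy hzy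
    · exact (huv x₁ hx₁ z hz).2 ▸ h.mono₂ x hx y hy x₁ hx₁ab z hz hyz

theorem affine_le_zero_of_threshold (h : IsComparable κ a b c d u v G) {p l c₁ c₂ : ℝ}
    (hp : p ∈ Ioo a b) (hl : 0 ≤ l)
    (hu_zero : ∀ x ∈ Ioo a b, ∀ y ∈ Ioo c d, x < p → u x y = 0)
    (hu : ∀ x ∈ Ioo a b, ∀ y ∈ Ioo c d, p < x → u x y = l * x + c₁)
    (hv : ∀ x ∈ Ioo a b, ∀ y ∈ Ioo c d, v x y = l * y + c₂) : l * p + c₁ ≤ 0 := by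
  by_contra! hpos
  obtain ⟨y₀, hy₀⟩ := exists_between h.lt₂
  obtain ⟨e, he, hed, hle⟩ := exists_pos_lt_mul_lt hl (sub_pos.2 hy₀.2) (lt_min h.κ_pos hpos)
  obtain ⟨x, ⟨hpx, hxb⟩, y, ⟨hy₀y, hye⟩, hxy⟩ := exists_mem_Ioo_of_subset_closure h.subset_closure
    (lt_min hp.2 (show p < p + e / 4 by linarith)) (show y₀ < y₀ + e / 4 by linarith)
    (Ioo_subset_Ioo hp.1.le (min_le_left _ _)) (Ioo_subset_Ioo hy₀.1.le (by linarith))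
  obtain ⟨x', ⟨hax', hx'p⟩, y', ⟨hy', hy'e⟩, hxy'⟩ := exists_mem_Ioo_of_subset_closure
    h.subset_closure (max_lt hp.1 (show p - e / 4 < p by linarith))
    (show y₀ + 3 * e / 4 < y₀ + e by linarith)
    (Ioo_subset_Ioo (le_max_left _ _) hp.2.le)
    (Ioo_subset_Ioo (by linarith [hy₀.1]) (by linarith))
  rw [lt_min_iff] at hxb hle
  rw [max_lt_iff] at hax'
  have hx : x ∈ Ioo a b := ⟨hp.1.trans hpx, hxb.1⟩
  have hx' : x' ∈ Ioo a b := ⟨hax'.1, hx'p.trans hp.2⟩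
  have hyI : y ∈ Ioo c d := ⟨hy₀.1.trans hy₀y, by linarith⟩
  have hyI' : y' ∈ Ioo c d := ⟨by linarith [hy₀.1], by linarith⟩
  have hlx : l * p ≤ l * x := mul_le_mul_of_nonneg_left hpx.le hl
  have hly : l * (y' - y) ≤ l * e := mul_le_mul_of_nonneg_left (by linarith) hl
  have hle_sum := h.add_le_add x hx y hyI x' hx' y' hyI' hxy hxy'
  rw [hu x hx y hyI hpx, hu_zero x' hx' y' hyI' hx'p, hv x hx y hyI, hv x' hx' y' hyI'] at hle_sum
  have hκ := h.κ_pos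
  linarith [hle_sum (by linarith) (by linarith) (by linarith) (lt_min (by linarith) (by linarith))]

theorem exists_eq_max_affine (h : IsComparable κ a b c d u v G)
    (hu : ∀ x ∈ Ioo a b, ∀ y ∈ Ioo c d, 0 ≤ u x y)
    (hpos : ∃ x ∈ Ioo a b, ∃ y ∈ Ioo c d, 0 < u x y) :
    ∃ l : ℝ, 0 ≤ l ∧ ∃ c₁ c₂, ∀ x ∈ Ioo a b, ∀ y ∈ Ioo c d,
      u x y = max (l * x + c₁) 0 ∧ v x y = l * y + c₂ := by
  obtain ⟨p, hp, hthreshold⟩ := exists_threshold (P := fun x y => 0 < u x y)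
    (fun x hx y hy x' hx' y' hy' hlt hxy => hxy.trans_le (h.mono₁ x hx y hy x' hx' y' hy' hlt)) hpos
  have hu_pos := fun x hx y hy => (hthreshold x hx y hy).2
  have hu_zero : ∀ x ∈ Ioo a b, ∀ y ∈ Ioo c d, x < p → u x y = 0 := fun x hx y hy hxp =>
    le_antisymm (not_lt.1 ((hthreshold x hx y hy).1 hxp)) (hu x hx y hy)
  obtain ⟨l, hl, c₁, c₂, hu_eq, hv_eq⟩ := h.exists_eq_affine_of_pos hp hu_pos
  refine ⟨l, hl, c₁, c₂, fun x hx y hy => ⟨?_, hv_eq x hx y hy⟩⟩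
  rcases lt_or_ge p x with hpx | hxp
  · rw [max_eq_left, hu_eq x hx y hy hpx]
    exact hu_eq x hx y hy hpx ▸ hu x hx y hy
  have hp' : p ∈ Ioo a b := ⟨hx.1.trans_le hxp, hp.2⟩
  have hlp := h.affine_le_zero_of_threshold hp' hl hu_zero hu_eq hv_eq
  have hlx : l * x ≤ l * p := mul_le_mul_of_nonneg_left hxp hl
  rw [max_eq_right (by linarith)]
  refine le_antisymm ?_ (hu x hx y hy)
  refine le_trans ?_ hlp
  refine le_of_forall_mem_Ioo_right (g := fun z => l * z + c₁) hp.2 fun z hz => ?_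
  have hz' : z ∈ Ioo a b := ⟨hp'.1.trans hz.1, hz.2⟩
  exact hu_eq z hz' y hy hz.1 ▸ h.mono₁ x hx y hy z hz' y hy (hxp.trans_lt hz.1)

end IsComparable

/-- The monotonicity properties of the critical values `f₁, f₂, f₁₂` for the bundles of the
`t`-player, as functions of the additive bid `(x, y)` of the `s`-player. -/
structure CriticalValues (B ε : ℝ) (f₁ f₂ f₁₂ : ℝ → ℝ → ℝ) : Prop where
  B_pos : 0 < B
  ε_pos : 0 < ε
  nonneg₁ : ∀ x ∈ Ioo 0 B, ∀ y ∈ Ioo 0 B, 0 ≤ f₁ x y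
  nonneg₂ : ∀ x ∈ Ioo 0 B, ∀ y ∈ Ioo 0 B, 0 ≤ f₂ x y
  le₁ : ∀ x ∈ Ioo 0 B, ∀ y ∈ Ioo 0 B, f₁ x y ≤ f₁₂ x y
  le₂ : ∀ x ∈ Ioo 0 B, ∀ y ∈ Ioo 0 B, f₂ x y ≤ f₁₂ x y
  mono₁ : ∀ x ∈ Ioo 0 B, ∀ y ∈ Ioo 0 B, ∀ x' ∈ Ioo 0 B, ∀ y' ∈ Ioo 0 B, x < x' →
    f₁ x y ≤ f₁ x' y'
  mono₂ : ∀ x ∈ Ioo 0 B, ∀ y ∈ Ioo 0 B, ∀ x' ∈ Ioo 0 B, ∀ y' ∈ Ioo 0 B, y < y' →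
    f₂ x y ≤ f₂ x' y'
  marginal₁ : ∀ x ∈ Ioo 0 B, ∀ y ∈ Ioo 0 B, ∀ x' ∈ Ioo 0 B, ∀ y' ∈ Ioo 0 B, x < x' →
    f₁ x y < f₁₂ x y → 0 < f₂ x' y' → f₁₂ x y - f₂ x y ≤ f₁₂ x' y' - f₂ x' y'
  marginal₂ : ∀ x ∈ Ioo 0 B, ∀ y ∈ Ioo 0 B, ∀ x' ∈ Ioo 0 B, ∀ y' ∈ Ioo 0 B, y < y' →
    f₂ x y < f₁₂ x y → 0 < f₁ x' y' → f₁₂ x y - f₁ x y ≤ f₁₂ x' y' - f₁ x' y'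
  mono₁₂ : ∀ x ∈ Ioo 0 B, ∀ y ∈ Ioo 0 B, ∀ x' ∈ Ioo 0 B, ∀ y' ∈ Ioo 0 B, x + y < x' + y' →
    f₁ x y < f₁₂ x y → f₂ x y < f₁₂ x y →
    f₁ x' y' + f₂ x y < f₁₂ x y + ε → f₂ x' y' + f₁ x y < f₁₂ x y + ε →
    f₁ x y + f₂ x y < f₁₂ x y + ε → f₁ x' y' + f₂ x' y' < f₁₂ x' y' + ε →
    f₁₂ x y ≤ f₁₂ x' y'
  diff : ∀ x ∈ Ioo 0 B, ∀ y ∈ Ioo 0 B, ∀ x' ∈ Ioo 0 B, ∀ y' ∈ Ioo 0 B, y' - x' < y - x →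
    f₁₂ x y - f₁ x y < f₂ x' y' → f₁₂ x' y' - f₂ x' y' < f₁ x y →
    f₁₂ x' y' - f₂ x' y' - f₂ x' y' < f₁ x y - f₂ x y →
    f₁ x' y' - f₂ x' y' < f₁ x y - (f₁₂ x y - f₁ x y) →
    f₁ x y - f₂ x y ≤ f₁ x' y' - f₂ x' y'

theorem CriticalValues.swap {B ε : ℝ} {f₁ f₂ f₁₂ : ℝ → ℝ → ℝ}
    (h : CriticalValues B ε f₁ f₂ f₁₂) :
    CriticalValues B ε (fun x y => f₂ y x) (fun x y => f₁ y x) (fun x y => f₁₂ y x) where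
  B_pos := h.B_pos
  ε_pos := h.ε_pos
  nonneg₁ x hx y hy := h.nonneg₂ y hy x hx
  nonneg₂ x hx y hy := h.nonneg₁ y hy x hx
  le₁ x hx y hy := h.le₂ y hy x hx
  le₂ x hx y hy := h.le₁ y hy x hx
  mono₁ x hx y hy x' hx' y' hy' := h.mono₂ y hy x hx y' hy' x' hx'
  mono₂ x hx y hy x' hx' y' hy' := h.mono₁ y hy x hx y' hy' x' hx'
  marginal₁ x hx y hy x' hx' y' hy' := h.marginal₂ y hy x hx y' hy' x' hx'
  marginal₂ x hx y hy x' hx' y' hy' := h.marginal₁ y hy x hx y' hy' x' hx'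
  mono₁₂ x hx y hy x' hx' y' hy' h0 h1 h2 h3 h4 h5 h6 :=
    h.mono₁₂ y hy x hx y' hy' x' hx' (by linarith) h2 h1 h4 h3 (by linarith) (by linarith)
  diff x hx y hy x' hx' y' hy' h0 h1 h2 h3 h4 := by
    have := h.diff y' hy' x' hx' y hy x hx (by linarith) h2 h1 (by linarith) (by linarith)
    linarith

/-- At the additive bid `(x, y)`, the critical values are those of an affine minimizer with
multiplicative constants `1` and `l` and additive constants `0, -c₁, -c₂, -c₁₂`. As `x, y < B`, real
constants suffice: a bundle is dropped by making its constant small. -/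
def IsAffineAt (l c₁ c₂ c₁₂ : ℝ) (f₁ f₂ f₁₂ : ℝ → ℝ → ℝ) (x y : ℝ) : Prop :=
  f₁ x y = max (l * x + c₁) 0 ∧ f₂ x y = max (l * y + c₂) 0 ∧
    f₁₂ x y = max (l * (x + y) + c₁₂) (max (f₁ x y) (f₂ x y))

theorem IsAffineAt.swap {l c₁ c₂ c₁₂ x y : ℝ} {f₁ f₂ f₁₂ : ℝ → ℝ → ℝ}
    (h : IsAffineAt l c₁ c₂ c₁₂ (fun x y => f₂ y x) (fun x y => f₁ y x) (fun x y => f₁₂ y x) y x) :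
    IsAffineAt l c₂ c₁ c₁₂ f₁ f₂ f₁₂ x y :=
  ⟨h.2.1, h.1, by rw [add_comm x y, max_comm (f₁ x y)]; exact h.2.2⟩

/-- The critical values of an affine minimizer, or of a constant mechanism (`l = 0`). -/
def IsAffineForm (B : ℝ) (f₁ f₂ f₁₂ : ℝ → ℝ → ℝ) : Prop :=
  ∃ l c₁ c₂ c₁₂ : ℝ, 0 ≤ l ∧ ∀ x ∈ Ioo 0 B, ∀ y ∈ Ioo 0 B, IsAffineAt l c₁ c₂ c₁₂ f₁ f₂ f₁₂ x y

/-- The critical values of an affine minimizer with a bundling tail, which consists of the bids with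
`x + y ≤ D`. -/
def IsTailForm (B : ℝ) (f₁ f₂ f₁₂ : ℝ → ℝ → ℝ) : Prop :=
  ∃ l c₁ c₂ c₁₂ D : ℝ, 0 < l ∧ 0 < D ∧ 0 ≤ l * D + c₁₂ ∧ max c₁ c₂ = -(l * D) ∧
    ∀ x ∈ Ioo 0 B, ∀ y ∈ Ioo 0 B, (D < x + y → IsAffineAt l c₁ c₂ c₁₂ f₁ f₂ f₁₂ x y) ∧
      (x + y ≤ D → f₁ x y = 0 ∧ f₂ x y = 0 ∧ f₁₂ x y ≤ l * D + c₁₂)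

/-- The critical values of a one-dimensional mechanism. -/
def IsOneDimensionalForm (B : ℝ) (f₁ f₂ f₁₂ : ℝ → ℝ → ℝ) : Prop :=
  (∀ x ∈ Ioo 0 B, ∀ y ∈ Ioo 0 B, f₁ x y = 0 ∧ f₂ x y = 0) ∨
    (∀ x ∈ Ioo 0 B, ∀ y ∈ Ioo 0 B, f₁ x y = 0 ∧ f₁₂ x y = f₂ x y) ∨
    ∀ x ∈ Ioo 0 B, ∀ y ∈ Ioo 0 B, f₂ x y = 0 ∧ f₁₂ x y = f₁ x y

/-- The critical values are of one of the types of the classification. -/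
def IsClassified (B : ℝ) (f₁ f₂ f₁₂ : ℝ → ℝ → ℝ) : Prop :=
  IsAffineForm B f₁ f₂ f₁₂ ∨ IsTailForm B f₁ f₂ f₁₂ ∨ IsOneDimensionalForm B f₁ f₂ f₁₂

theorem IsClassified.swap {B : ℝ} {f₁ f₂ f₁₂ : ℝ → ℝ → ℝ}
    (h : IsClassified B (fun x y => f₂ y x) (fun x y => f₁ y x) (fun x y => f₁₂ y x)) :
    IsClassified B f₁ f₂ f₁₂ := by
  rcases h with ⟨l, c₂, c₁, c₁₂, hl, h⟩ | ⟨l, c₂, c₁, c₁₂, D, hl, hD, hc₁₂, hc, h⟩ | h | h | h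
  · exact Or.inl ⟨l, c₁, c₂, c₁₂, hl, fun x hx y hy => (h y hy x hx).swap⟩
  · refine Or.inr (Or.inl ⟨l, c₁, c₂, c₁₂, D, hl, hD, hc₁₂, max_comm c₁ c₂ ▸ hc,
      fun x hx y hy => ?_⟩)
    rw [add_comm x y]
    exact ⟨fun hlt => ((h y hy x hx).1 hlt).swap, fun hle =>
      ⟨((h y hy x hx).2 hle).2.1, ((h y hy x hx).2 hle).1, ((h y hy x hx).2 hle).2.2⟩⟩
  · exact Or.inr (Or.inr (Or.inl fun x hx y hy => (h y hy x hx).symm))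
  · exact Or.inr (Or.inr (Or.inr (Or.inr fun x hx y hy => h y hy x hx)))
  · exact Or.inr (Or.inr (Or.inr (Or.inl fun x hx y hy => h y hy x hx)))

/-- On the rectangle `(p, q) × (r, s)` the bundles `1` and `2` compete for the `t`-player, uniformly
so: the critical value of both tasks is less than `f₁ + f₂` by at least `κ`. -/
structure IsGap (B κ p q r s : ℝ) (f₁ f₂ f₁₂ : ℝ → ℝ → ℝ) : Prop where
  κ_pos : 0 < κ
  lt₁ : p < q
  lt₂ : r < s
  subset₁ : Ioo p q ⊆ Ioo 0 B
  subset₂ : Ioo r s ⊆ Ioo 0 B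
  add_le : ∀ x ∈ Ioo p q, ∀ y ∈ Ioo r s, f₁₂ x y + κ ≤ f₁ x y + f₂ x y

theorem IsGap.swap {B κ p q r s : ℝ} {f₁ f₂ f₁₂ : ℝ → ℝ → ℝ} (h : IsGap B κ p q r s f₁ f₂ f₁₂) :
    IsGap B κ r s p q (fun x y => f₂ y x) (fun x y => f₁ y x) (fun x y => f₁₂ y x) where
  κ_pos := h.κ_pos
  lt₁ := h.lt₂
  lt₂ := h.lt₁
  subset₁ := h.subset₂
  subset₂ := h.subset₁
  add_le y hy x hx := (h.add_le x hx y hy).trans_eq (add_comm _ _)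

namespace CriticalValues

variable {B ε : ℝ} {f₁ f₂ f₁₂ : ℝ → ℝ → ℝ}

theorem eq_of_eq_on_row (h : CriticalValues B ε f₁ f₂ f₁₂) {p q y₀ : ℝ} {g : ℝ → ℝ}
    (hg : Continuous g) (hpq : Ioo p q ⊆ Ioo 0 B) (hy₀ : y₀ ∈ Ioo 0 B)
    (hf₁ : ∀ x ∈ Ioo p q, f₁ x y₀ = g x) : ∀ x ∈ Ioo p q, ∀ y ∈ Ioo 0 B, f₁ x y = g x := by
  intro x hx y hy
  refine eq_of_forall_mem_Ioo hx (fun z hz hzx => ?_) (fun z hz hxz => ?_) hg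
  · exact hf₁ z hz ▸ h.mono₁ z (hpq hz) y₀ hy₀ x (hpq hx) y hy hzx
  · exact hf₁ z hz ▸ h.mono₁ x (hpq hx) y hy z (hpq hz) y₀ hy₀ hxz

theorem eq_of_eq_on_column (h : CriticalValues B ε f₁ f₂ f₁₂) {r s x₀ : ℝ} {g : ℝ → ℝ}
    (hg : Continuous g) (hrs : Ioo r s ⊆ Ioo 0 B) (hx₀ : x₀ ∈ Ioo 0 B)
    (hf₂ : ∀ y ∈ Ioo r s, f₂ x₀ y = g y) : ∀ x ∈ Ioo 0 B, ∀ y ∈ Ioo r s, f₂ x y = g y :=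
  fun x hx y hy => h.swap.eq_of_eq_on_row hg hrs hx₀ hf₂ y hy x hx

theorem exists_eq_max_affine_of_gap_or_le (h : CriticalValues B ε f₁ f₂ f₁₂) {p q r s κ : ℝ}
    (hpq : p < q) (hrs : r < s) (hI : Ioo p q ⊆ Ioo 0 B) (hJ : Ioo r s ⊆ Ioo 0 B) (hκ : 0 < κ)
    (hgap : ∀ x ∈ Ioo p q, ∀ y ∈ Ioo r s,
      f₁₂ x y + κ ≤ f₁ x y + f₂ x y ∨ f₁₂ x y ≤ f₂ x y)
    (hpos : ∃ x ∈ Ioo p q, ∃ y ∈ Ioo r s, 0 < f₁ x y) :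
    ∃ l : ℝ, 0 ≤ l ∧ ∃ c₁ c₂, ∀ x ∈ Ioo p q, ∀ y ∈ Ioo r s,
      f₁ x y = max (l * x + c₁) 0 ∧ f₂ x y = l * y + c₂ := by
  have hneg : ∀ {y : ℝ}, y ∈ Ioo (-s) (-r) → -y ∈ Ioo r s :=
    fun hy => ⟨by linarith [hy.2], by linarith [hy.1]⟩
  have comparable : IsComparable κ p q (-s) (-r) (fun x y => f₁ x (-y)) (fun x y => -f₂ x (-y))
      univ :=
    { lt₁ := hpq
      lt₂ := neg_lt_neg hrs
      κ_pos := hκ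
      mono₁ := fun x hx y hy x' hx' y' hy' => h.mono₁ x (hI hx) _ (hJ (hneg hy)) x' (hI hx') _
        (hJ (hneg hy'))
      mono₂ := fun x hx y hy x' hx' y' hy' hlt => neg_le_neg
        (h.mono₂ x' (hI hx') _ (hJ (hneg hy')) x (hI hx) _ (hJ (hneg hy)) (neg_lt_neg hlt))
      subset_closure := by simp
      add_le_add := by
        intro x hx y hy x' hx' y' hy' _ _ hlt hpos h₁κ h₂κ
        have hle := h.le₁ x (hI hx) _ (hJ (hneg hy))
        have hle' := h.nonneg₂ x' (hI hx') _ (hJ (hneg hy'))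
        rw [lt_min_iff] at h₂κ
        by_contra! hcon
        have hdiff := h.diff x (hI hx) _ (hJ (hneg hy)) x' (hI hx') _ (hJ (hneg hy'))
          (by linarith)
        rcases hgap x hx _ (hneg hy) with hP | hP <;>
          rcases hgap x' hx' _ (hneg hy') with hP' | hP' <;>
          linarith [hdiff (by linarith) (by linarith) (by linarith) (by linarith)] }
  obtain ⟨x₀, hx₀, y₀, hy₀, hpos₀⟩ := hpos
  obtain ⟨l, hl, c₁, c₂, heq⟩ := comparable.exists_eq_max_affine
    (fun x hx y hy => h.nonneg₁ x (hI hx) _ (hJ (hneg hy)))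
    ⟨x₀, hx₀, -y₀, ⟨neg_lt_neg hy₀.2, neg_lt_neg hy₀.1⟩, by rwa [neg_neg]⟩
  refine ⟨l, hl, c₁, -c₂, fun x hx y hy => ?_⟩
  have hxy := heq x hx (-y) ⟨neg_lt_neg hy.2, neg_lt_neg hy.1⟩
  rw [neg_neg] at hxy
  exact ⟨hxy.1, by linarith [hxy.2]⟩

theorem gap_or_le_on_strip (h : CriticalValues B ε f₁ f₂ f₁₂) {p q r s κ l c : ℝ}
    (hgap : IsGap B κ p q r s f₁ f₂ f₁₂)
    (hf₂ : ∀ x ∈ Ioo 0 B, ∀ y ∈ Ioo r s, f₂ x y = l * y + c) :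
    ∀ x ∈ Ioo 0 B, ∀ y ∈ Ioo r s, f₁₂ x y + κ ≤ f₁ x y + f₂ x y ∨ f₁₂ x y ≤ f₂ x y := by
  intro x hx y hy
  refine or_iff_not_imp_right.2 fun hlt => ?_
  obtain ⟨w, hw⟩ := exists_between hgap.lt₁
  have hwB := hgap.subset₁ hw
  suffices f₁₂ x y - f₁ x y ≤ l * y + (c - κ) by linarith [hf₂ x hx y hy]
  refine le_of_forall_mem_Ioo_right (g := fun z => l * z + (c - κ)) hy.2 fun z hz => ?_
  have hzr : z ∈ Ioo r s := ⟨hy.1.trans hz.1, hz.2⟩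
  have hzB := hgap.subset₂ hzr
  have hadd := hgap.add_le w hw z hzr
  have hmarginal := h.marginal₂ x hx y (hgap.subset₂ hy) w hwB z hzB hz.1 (not_le.1 hlt)
    (by linarith [h.le₂ w hwB z hzB, hgap.κ_pos])
  linarith [hf₂ w hwB z hzr]

theorem exists_eq_max_affine_of_gap (h : CriticalValues B ε f₁ f₂ f₁₂) {p q r s κ : ℝ}
    (hgap : IsGap B κ p q r s f₁ f₂ f₁₂) :
    ∃ l : ℝ, 0 ≤ l ∧ ∃ c₁ c₂, (∀ x ∈ Ioo 0 B, ∀ y ∈ Ioo 0 B, f₁ x y = max (l * x + c₁) 0) ∧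
      ∀ x ∈ Ioo 0 B, ∀ y ∈ Ioo r s,
        f₂ x y = l * y + c₂ ∧ 0 < f₂ x y ∧ f₁₂ x y ≤ f₁ x y + f₂ x y := by
  obtain ⟨x₀, hx₀⟩ := exists_between hgap.lt₁
  obtain ⟨y₀, hy₀⟩ := exists_between hgap.lt₂
  have hx₀B := hgap.subset₁ hx₀
  have hy₀B := hgap.subset₂ hy₀
  have hpos : 0 < f₁ x₀ y₀ := by
    linarith [hgap.add_le x₀ hx₀ y₀ hy₀, h.le₂ x₀ hx₀B y₀ hy₀B, hgap.κ_pos]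
  obtain ⟨l', -, _, c', hrect⟩ := h.exists_eq_max_affine_of_gap_or_le hgap.lt₁ hgap.lt₂
    hgap.subset₁ hgap.subset₂ hgap.κ_pos (fun x hx y hy => Or.inl (hgap.add_le x hx y hy))
    ⟨x₀, hx₀, y₀, hy₀, hpos⟩
  have hstrip := h.gap_or_le_on_strip hgap <| h.eq_of_eq_on_column (g := fun y => l' * y + c')
    (by fun_prop) hgap.subset₂ hx₀B fun y hy => (hrect x₀ hx₀ y hy).2
  obtain ⟨l, hl, c₁, c₂, heq⟩ := h.exists_eq_max_affine_of_gap_or_le h.B_pos hgap.lt₂ subset_rfl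
    hgap.subset₂ hgap.κ_pos hstrip ⟨x₀, hx₀B, y₀, hy₀, hpos⟩
  refine ⟨l, hl, c₁, c₂, h.eq_of_eq_on_row (g := fun x => max (l * x + c₁) 0) (by fun_prop)
    subset_rfl hy₀B fun x hx => (heq x hx y₀ hy₀).1,
    fun x hx y hy => ⟨(heq x hx y hy).2, ?_, ?_⟩⟩
  · linarith [(heq x hx y hy).2, (heq x₀ hx₀B y hy).2, hgap.add_le x₀ hx₀ y hy,
      h.le₁ x₀ hx₀B y (hgap.subset₂ hy), hgap.κ_pos]
  · rcases hstrip x hx y hy with hle | hle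
    · linarith [hgap.κ_pos]
    · linarith [h.nonneg₁ x hx y (hgap.subset₂ hy)]

theorem pos_of_active (h : CriticalValues B ε f₁ f₂ f₁₂) {l c y₀ : ℝ} (hy₀ : y₀ ∈ Ioo 0 B)
    (hf₁ : ∀ x ∈ Ioo 0 B, f₁ x y₀ = max (l * x + c) 0) (hf₂ : ∀ x ∈ Ioo 0 B, 0 < f₂ x y₀)
    (hle : ∀ x ∈ Ioo 0 B, f₁₂ x y₀ ≤ f₁ x y₀ + f₂ x y₀) {x y : ℝ} (hx : x ∈ Ioo 0 B)
    (hy : y ∈ Ioo 0 B) (hlt₁ : f₁ x y < f₁₂ x y) (hlt₂ : f₂ x y < f₁₂ x y) : 0 < l * x + c := by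
  have hle_max : f₁₂ x y - f₂ x y ≤ max (l * x + c) 0 := by
    refine le_of_forall_mem_Ioo_right (g := fun z => max (l * z + c) 0) hx.2 fun z hz => ?_
    have hzB : z ∈ Ioo 0 B := ⟨hx.1.trans hz.1, hz.2⟩
    have := h.marginal₁ x hx y hy z hzB y₀ hy₀ hz.1 hlt₁ (hf₂ z hzB)
    rw [← hf₁ z hzB]
    linarith [hle z hzB]
  by_contra! hneg
  rw [max_eq_right hneg] at hle_max
  linarith

theorem excess_le_of_active (h : CriticalValues B ε f₁ f₂ f₁₂) {l c₁ c₂ : ℝ} (hl : 0 ≤ l)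
    (hf₁ : ∀ x ∈ Ioo 0 B, ∀ y ∈ Ioo 0 B, f₁ x y = max (l * x + c₁) 0)
    (hf₂ : ∀ x ∈ Ioo 0 B, ∀ y ∈ Ioo 0 B, f₂ x y = max (l * y + c₂) 0) {x₀ y₀ x y : ℝ}
    (hx₀ : x₀ ∈ Ioo 0 B) (hy₀ : y₀ ∈ Ioo 0 B) (hx : x ∈ Ioo 0 B) (hy : y ∈ Ioo 0 B)
    (hlt₁ : f₁ x₀ y₀ < f₁₂ x₀ y₀) (hlt₂ : f₂ x₀ y₀ < f₁₂ x₀ y₀) (hpos₀ : 0 < l * y₀ + c₂)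
    (hpos₁ : 0 < l * x + c₁) (hpos₂ : 0 < l * y + c₂) :
    f₁ x y + f₂ x y - f₁₂ x y ≤ f₁ x₀ y₀ + f₂ x₀ y₀ - f₁₂ x₀ y₀ := by
  obtain ⟨δ, hδ, hδx, hlδ⟩ := exists_pos_lt_mul_lt hl (lt_min hx.1 (sub_pos.2 hy₀.2)) hpos₁
  rw [lt_min_iff] at hδx
  suffices l * (2 * x - x - y₀) + c₁ - c₂ + f₁₂ x₀ y₀ - f₁ x₀ y₀ ≤ f₁₂ x y - f₂ x y by
    rw [hf₁ x hx y hy, hf₂ x₀ hx₀ y₀ hy₀, max_eq_left hpos₁.le, max_eq_left hpos₀.le]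
    linarith
  refine le_of_forall_mem_Ioo_left
    (g := fun z => l * (2 * z - x - y₀) + c₁ - c₂ + f₁₂ x₀ y₀ - f₁ x₀ y₀)
    (show x - δ < x by linarith) fun z hz => ?_
  have hzB : z ∈ Ioo 0 B := ⟨by linarith [hz.1], by linarith [hz.2, hx.2]⟩
  have hwB : y₀ + (x - z) ∈ Ioo 0 B := ⟨by linarith [hz.2, hy₀.1], by linarith [hz.1]⟩
  have hlz : l * (x - z) ≤ l * δ := mul_le_mul_of_nonneg_left (by linarith [hz.1]) hl
  have hlw : 0 ≤ l * (x - z) := mul_nonneg hl (by linarith [hz.2])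
  have hf₁z := hf₁ z hzB _ hwB
  have hf₂z := hf₂ z hzB _ hwB
  rw [max_eq_left (by linarith)] at hf₁z hf₂z
  have step₁ := h.marginal₂ x₀ hx₀ y₀ hy₀ z hzB _ hwB (by linarith [hz.2]) hlt₂ (by linarith)
  have step₂ := h.marginal₁ z hzB _ hwB x hx y hy hz.2
    (by linarith) (by rw [hf₂ x hx y hy]; exact lt_max_of_lt_left hpos₂)
  linarith

theorem exists_common_max_affine_of_gap (h : CriticalValues B ε f₁ f₂ f₁₂) {p q r s κ : ℝ}
    (hgap : IsGap B κ p q r s f₁ f₂ f₁₂) :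
    ∃ l : ℝ, 0 ≤ l ∧ ∃ c₁ c₂,
      (∀ x ∈ Ioo 0 B, ∀ y ∈ Ioo 0 B, f₁ x y = max (l * x + c₁) 0) ∧
      (∀ x ∈ Ioo 0 B, ∀ y ∈ Ioo 0 B, f₂ x y = max (l * y + c₂) 0) ∧
      ∀ x ∈ Ioo 0 B, ∀ y ∈ Ioo 0 B, f₁ x y < f₁₂ x y → f₂ x y < f₁₂ x y →
        0 < l * x + c₁ ∧ 0 < l * y + c₂ := by
  obtain ⟨l, hl, c₁, d₂, hf₁, hstrip₂⟩ := h.exists_eq_max_affine_of_gap hgap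
  obtain ⟨l', -, c₂, d₁, hf₂, hstrip₁⟩ := h.swap.exists_eq_max_affine_of_gap hgap.swap
  obtain ⟨x₀, hx₀⟩ := exists_between hgap.lt₁
  obtain ⟨y₀, hy₀⟩ := exists_between hgap.lt₂
  have hx₀B := hgap.subset₁ hx₀
  have hy₀B := hgap.subset₂ hy₀
  have slope_eq : l = l' := (affine_unique hgap.lt₂ fun y hy => by
    obtain ⟨hf₂_eq, hf₂_pos, -⟩ := hstrip₂ x₀ hx₀B y hy
    have hmax := hf₂ y (hgap.subset₂ hy) x₀ hx₀B
    have hpos : 0 < l' * y + c₂ := by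
      rw [hmax] at hf₂_pos
      simpa using hf₂_pos
    rw [max_eq_left hpos.le] at hmax
    rw [← hf₂_eq, hmax]).1
  subst slope_eq
  refine ⟨l, hl, c₁, c₂, hf₁, fun x hx y hy => hf₂ y hy x hx,
    fun x hx y hy hlt₁ hlt₂ => ⟨?_, ?_⟩⟩
  · exact h.pos_of_active hy₀B (fun x hx => hf₁ x hx y₀ hy₀B)
      (fun x hx => (hstrip₂ x hx y₀ hy₀).2.1) (fun x hx => (hstrip₂ x hx y₀ hy₀).2.2)
      hx hy hlt₁ hlt₂
  · exact h.swap.pos_of_active hx₀B (fun y hy => hf₂ y hy x₀ hx₀B)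
      (fun y hy => (hstrip₁ y hy x₀ hx₀).2.1) (fun y hy => (hstrip₁ y hy x₀ hx₀).2.2)
      hy hx hlt₂ hlt₁

theorem isAffineAt_of_le (h : CriticalValues B ε f₁ f₂ f₁₂) {l c₁ c₂ c₁₂ x y : ℝ}
    (hx : x ∈ Ioo 0 B) (hy : y ∈ Ioo 0 B) (hf₁ : f₁ x y = max (l * x + c₁) 0)
    (hf₂ : f₂ x y = max (l * y + c₂) 0) (hle : l * (x + y) + c₁₂ ≤ f₁₂ x y)
    (hactive : f₁ x y < f₁₂ x y → f₂ x y < f₁₂ x y → f₁₂ x y ≤ l * (x + y) + c₁₂) :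
    IsAffineAt l c₁ c₂ c₁₂ f₁ f₂ f₁₂ x y := by
  refine ⟨hf₁, hf₂, le_antisymm ?_ (max_le hle (max_le (h.le₁ x hx y hy) (h.le₂ x hx y hy)))⟩
  by_cases hlt : f₁ x y < f₁₂ x y ∧ f₂ x y < f₁₂ x y
  · exact le_max_of_le_left (hactive hlt.1 hlt.2)
  · rw [not_and_or, not_lt, not_lt] at hlt
    exact le_max_of_le_right (le_max_iff.2 hlt)

theorem isAffineForm_of_active (h : CriticalValues B ε f₁ f₂ f₁₂) {l c₁ c₂ : ℝ} (hl : 0 ≤ l)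
    (hf₁ : ∀ x ∈ Ioo 0 B, ∀ y ∈ Ioo 0 B, f₁ x y = max (l * x + c₁) 0)
    (hf₂ : ∀ x ∈ Ioo 0 B, ∀ y ∈ Ioo 0 B, f₂ x y = max (l * y + c₂) 0)
    (hactive : ∀ x ∈ Ioo 0 B, ∀ y ∈ Ioo 0 B, f₁ x y < f₁₂ x y → f₂ x y < f₁₂ x y →
      0 < l * x + c₁ ∧ 0 < l * y + c₂)
    {x₀ y₀ x₁ y₁ : ℝ} (hx₀ : x₀ ∈ Ioo 0 B) (hy₀ : y₀ ∈ Ioo 0 B) (hlt₁ : f₁ x₀ y₀ < f₁₂ x₀ y₀)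
    (hlt₂ : f₂ x₀ y₀ < f₁₂ x₀ y₀) (hx₁ : x₁ ∈ Ioo 0 B) (hy₁ : y₁ ∈ Ioo 0 B)
    (hadd : f₁₂ x₁ y₁ < f₁ x₁ y₁ + f₂ x₁ y₁) : IsAffineForm B f₁ f₂ f₁₂ := by
  obtain ⟨hpos₁, hpos₂⟩ := hactive x₀ hx₀ y₀ hy₀ hlt₁ hlt₂
  have excess_le := fun x hx y hy => h.excess_le_of_active hl hf₁ hf₂ hx₀ hy₀ hx hy hlt₁ hlt₂
    hpos₂ (x := x) (y := y)
  have excess_nonneg : 0 ≤ f₁ x₀ y₀ + f₂ x₀ y₀ - f₁₂ x₀ y₀ := by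
    have hf₁_pos : 0 < f₁ x₁ y₁ := by linarith [h.le₂ x₁ hx₁ y₁ hy₁]
    have hf₂_pos : 0 < f₂ x₁ y₁ := by linarith [h.le₁ x₁ hx₁ y₁ hy₁]
    rw [hf₁ x₁ hx₁ y₁ hy₁, lt_max_iff, or_iff_left (lt_irrefl 0)] at hf₁_pos
    rw [hf₂ x₁ hx₁ y₁ hy₁, lt_max_iff, or_iff_left (lt_irrefl 0)] at hf₂_pos
    linarith [excess_le x₁ hx₁ y₁ hy₁ hf₁_pos hf₂_pos]
  refine ⟨l, c₁, c₂, c₁ + c₂ - (f₁ x₀ y₀ + f₂ x₀ y₀ - f₁₂ x₀ y₀), hl, fun x hx y hy =>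
    h.isAffineAt_of_le hx hy (hf₁ x hx y hy) (hf₂ x hx y hy) ?_ fun hlt₁' hlt₂' => ?_⟩
  · have hle₁ := (hf₁ x hx y hy).symm.trans_le (h.le₁ x hx y hy)
    have hle₂ := (hf₂ x hx y hy).symm.trans_le (h.le₂ x hx y hy)
    rw [max_le_iff] at hle₁ hle₂
    by_cases hpos : 0 < l * x + c₁ ∧ 0 < l * y + c₂
    · have hle := excess_le x hx y hy hpos.1 hpos.2
      rw [hf₁ x hx y hy, hf₂ x hx y hy, max_eq_left hpos.1.le, max_eq_left hpos.2.le] at hle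
      linarith
    · rw [not_and_or, not_lt, not_lt] at hpos
      rcases hpos with hneg | hneg <;> linarith
  · obtain ⟨hpos₁', hpos₂'⟩ := hactive x hx y hy hlt₁' hlt₂'
    have hle := h.excess_le_of_active hl hf₁ hf₂ hx hy hx₀ hy₀ hlt₁' hlt₂' hpos₂' hpos₁ hpos₂
    rw [hf₁ x hx y hy, hf₂ x hx y hy, max_eq_left hpos₁'.le, max_eq_left hpos₂'.le] at hle
    linarith

theorem isAffineForm_of_gap (h : CriticalValues B ε f₁ f₂ f₁₂) {p q r s κ : ℝ}
    (hgap : IsGap B κ p q r s f₁ f₂ f₁₂) : IsAffineForm B f₁ f₂ f₁₂ := by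
  obtain ⟨l, hl, c₁, c₂, hf₁, hf₂, hactive⟩ := h.exists_common_max_affine_of_gap hgap
  by_cases hex : ∃ x ∈ Ioo 0 B, ∃ y ∈ Ioo 0 B, f₁ x y < f₁₂ x y ∧ f₂ x y < f₁₂ x y
  · obtain ⟨x₀, hx₀, y₀, hy₀, hlt₁, hlt₂⟩ := hex
    obtain ⟨x₁, hx₁⟩ := exists_between hgap.lt₁
    obtain ⟨y₁, hy₁⟩ := exists_between hgap.lt₂
    exact h.isAffineForm_of_active hl hf₁ hf₂ hactive hx₀ hy₀ hlt₁ hlt₂ (hgap.subset₁ hx₁)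
      (hgap.subset₂ hy₁) (by linarith [hgap.add_le x₁ hx₁ y₁ hy₁, hgap.κ_pos])
  · push Not at hex
    refine ⟨l, c₁, c₂, -(2 * (l * B)), hl, fun x hx y hy =>
      h.isAffineAt_of_le hx hy (hf₁ x hx y hy) (hf₂ x hx y hy) ?_ fun hlt₁ hlt₂ =>
        absurd (hex x hx y hy hlt₁) hlt₂.not_ge⟩
    linarith [mul_le_mul_of_nonneg_left hx.2.le hl, mul_le_mul_of_nonneg_left hy.2.le hl,
      h.nonneg₁ x hx y hy, h.le₁ x hx y hy]

end CriticalValues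

/-- The bundles `1` and `2` compete on no rectangle. -/
def HasNoGap (B : ℝ) (f₁ f₂ f₁₂ : ℝ → ℝ → ℝ) : Prop :=
  ∀ κ p q r s, ¬IsGap B κ p q r s f₁ f₂ f₁₂

namespace HasNoGap

variable {B : ℝ} {f₁ f₂ f₁₂ : ℝ → ℝ → ℝ}

theorem swap (h : HasNoGap B f₁ f₂ f₁₂) :
    HasNoGap B (fun x y => f₂ y x) (fun x y => f₁ y x) (fun x y => f₁₂ y x) :=
  fun κ p q r s hgap => h κ r s p q hgap.swap

theorem subset_closure (h : HasNoGap B f₁ f₂ f₁₂) {η : ℝ} (hη : 0 < η) :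
    Ioo 0 B ×ˢ Ioo 0 B ⊆ closure {P : ℝ × ℝ | f₁ P.1 P.2 + f₂ P.1 P.2 ≤ f₁₂ P.1 P.2 + η} := by
  rintro ⟨x, y⟩ ⟨hx, hy⟩
  by_contra hnot
  have hnhds := Filter.inter_mem (isClosed_closure.isOpen_compl.mem_nhds hnot)
    ((isOpen_Ioo.prod isOpen_Ioo).mem_nhds (mk_mem_prod hx hy))
  obtain ⟨⟨⟨p, q⟩, ⟨r, s⟩⟩, ⟨hpq, hrs⟩, hsub⟩ :=
    ((nhds_basis_Ioo x).prod_nhds (nhds_basis_Ioo y)).mem_iff.1 hnhds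
  refine h η p q r s ⟨hη, hpq.1.trans hpq.2, hrs.1.trans hrs.2, fun z hz => ?_, fun z hz => ?_,
    fun z hz w hw => ?_⟩
  · exact (hsub (mk_mem_prod hz hrs)).2.1
  · exact (hsub (mk_mem_prod hpq hz)).2.2
  · by_contra! hlt
    exact (hsub (mk_mem_prod hz hw)).1 (_root_.subset_closure hlt.le)

end HasNoGap

/-- Task `2` has the critical value of an affine minimizer, and wherever it is positive, the
`t`-player receives task `1` on top of task `2` at the marginal critical value
`max (l * x + d) 0`. -/
structure HasAffineMarginal (B l c d : ℝ) (f₁ f₂ f₁₂ : ℝ → ℝ → ℝ) : Prop where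
  nonneg : 0 ≤ l
  pos₁ : 0 < l * B + d
  pos₂ : 0 < l * B + c
  eq₂ : ∀ x ∈ Ioo 0 B, ∀ y ∈ Ioo 0 B, f₂ x y = max (l * y + c) 0
  eq₁₂ : ∀ x ∈ Ioo 0 B, ∀ y ∈ Ioo 0 B, 0 < l * y + c → f₁₂ x y = l * y + c + max (l * x + d) 0

namespace CriticalValues

variable {B ε : ℝ} {f₁ f₂ f₁₂ : ℝ → ℝ → ℝ}

theorem lt_of_hasNoGap (h : CriticalValues B ε f₁ f₂ f₁₂) (hgap : HasNoGap B f₁ f₂ f₁₂) {b : ℝ}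
    (hb : 0 ≤ b) (hf₂ : ∀ x ∈ Ioo 0 B, ∀ y ∈ Ioo b B, 0 < f₂ x y) :
    ∀ x ∈ Ioo 0 B, ∀ y ∈ Ioo b B, f₁ x y < f₁₂ x y := by
  intro x hx y hy
  have hyB : y ∈ Ioo 0 B := ⟨hb.trans_lt hy.1, hy.2⟩
  by_contra! hle
  obtain ⟨w, hbw, hwy⟩ := exists_between hy.1
  have hwB : w ∈ Ioo 0 B := ⟨hb.trans_lt hbw, hwy.trans hy.2⟩
  have hf₂w := hf₂ x hx w ⟨hbw, hwB.2⟩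
  have hf₁ : 0 < f₁ x y := by linarith [hf₂ x hx y hy, h.le₂ x hx y hyB]
  obtain ⟨η, hη, hη_lt⟩ := exists_between (lt_min hf₁ hf₂w)
  rw [lt_min_iff] at hη_lt
  obtain ⟨x', hx', y', hy', hadd⟩ := exists_mem_Ioo_of_subset_closure (hgap.subset_closure hη)
    hx.2 hwy (Ioo_subset_Ioo_left hx.1.le) (Ioo_subset_Ioo hwB.1.le hy.2.le)
  have hx'B : x' ∈ Ioo 0 B := ⟨hx.1.trans hx'.1, hx'.2⟩
  have hy'B : y' ∈ Ioo 0 B := ⟨hwB.1.trans hy'.1, hy'.2.trans hy.2⟩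
  have hadd' : f₁ x' y' + f₂ x' y' ≤ f₁₂ x' y' + η := hadd
  have hmono₁ := h.mono₁ x hx y hyB x' hx'B y' hy'B hx'.1
  have hmono₂ := h.mono₂ x hx w hwB x' hx'B y' hy'B hy'.1
  have := h.marginal₂ x' hx'B y' hy'B x hx y hyB hy'.2 (by linarith) hf₁
  linarith

theorem exists_eq_max_affine_of_hasNoGap (h : CriticalValues B ε f₁ f₂ f₁₂)
    (hgap : HasNoGap B f₁ f₂ f₁₂) {b : ℝ} (hb : b ∈ Ico 0 B)
    (hf₂ : ∀ x ∈ Ioo 0 B, ∀ y ∈ Ioo b B, 0 < f₂ x y)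
    (hlt : ∃ x ∈ Ioo 0 B, ∃ y ∈ Ioo b B, f₂ x y < f₁₂ x y) :
    ∃ l : ℝ, 0 ≤ l ∧ ∃ d c, ∀ x ∈ Ioo 0 B, ∀ y ∈ Ioo b B,
      f₁₂ x y - f₂ x y = max (l * x + d) 0 ∧ f₂ x y = l * y + c := by
  have hε := h.ε_pos
  have hlt₁ := h.lt_of_hasNoGap hgap hb.1 hf₂
  have hsub : ∀ {y}, y ∈ Ioo b B → y ∈ Ioo 0 B := fun hy => ⟨hb.1.trans_lt hy.1, hy.2⟩
  have comparable : IsComparable (ε / 2) 0 B b B (fun x y => f₁₂ x y - f₂ x y) f₂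
      {P | f₁ P.1 P.2 + f₂ P.1 P.2 ≤ f₁₂ P.1 P.2 + ε / 4} :=
    { lt₁ := h.B_pos
      lt₂ := hb.2
      κ_pos := half_pos hε
      mono₁ := fun x hx y hy x' hx' y' hy' hxx' => h.marginal₁ x hx y (hsub hy) x' hx' y' (hsub hy')
        hxx' (hlt₁ x hx y hy) (hf₂ x' hx' y' hy')
      mono₂ := fun x hx y hy x' hx' y' hy' => h.mono₂ x hx y (hsub hy) x' hx' y' (hsub hy')
      subset_closure := (prod_mono_right fun _ => hsub).trans
        (hgap.subset_closure (by positivity))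
      add_le_add := by
        intro x hx y hy x' hx' y' hy' hadd hadd' hxy hpos hu hv
        simp only [mem_ofPred_eq] at hadd hadd'
        rw [lt_min_iff] at hv
        linarith [h.mono₁₂ x hx y (hsub hy) x' hx' y' (hsub hy') hxy (hlt₁ x hx y hy)
          (by linarith) (by linarith) (by linarith) (by linarith) (by linarith)] }
  obtain ⟨x, hx, y, hy, hxy⟩ := hlt
  exact comparable.exists_eq_max_affine
    (fun x hx y hy => sub_nonneg.2 (h.le₂ x hx y (hsub hy))) ⟨x, hx, y, hy, sub_pos.2 hxy⟩

theorem le_add_of_marginal_eq (h : CriticalValues B ε f₁ f₂ f₁₂) (hgap : HasNoGap B f₁ f₂ f₁₂)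
    {b : ℝ} (hb : b ∈ Ico 0 B) (hf₂ : ∀ x ∈ Ioo 0 B, ∀ y ∈ Ioo b B, 0 < f₂ x y) {g : ℝ → ℝ}
    (hg : Continuous g) (hg_mono : Monotone g)
    (hmarginal : ∀ x ∈ Ioo 0 B, ∀ y ∈ Ioo b B, f₁₂ x y - f₂ x y = g x) :
    ∀ x ∈ Ioo 0 B, ∀ y ∈ Ioo 0 B, f₁ x y ≤ g x ∧ f₁₂ x y ≤ f₂ x y + g x := by
  intro x hx y hy
  have hf₁ : f₁ x y ≤ g x := by
    refine le_of_forall_mem_Ioo_right hx.2 (fun z hz => le_of_forall_pos_le_add fun η hη => ?_) hg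
    obtain ⟨x', hx', y', hy', hadd⟩ := exists_mem_Ioo_of_subset_closure (hgap.subset_closure hη)
      hz.1 hb.2 (Ioo_subset_Ioo hx.1.le hz.2.le) (Ioo_subset_Ioo_left hb.1)
    have hx'B : x' ∈ Ioo 0 B := ⟨hx.1.trans hx'.1, hx'.2.trans hz.2⟩
    have hadd' : f₁ x' y' + f₂ x' y' ≤ f₁₂ x' y' + η := hadd
    linarith [h.mono₁ x hx y hy x' hx'B y' ⟨hb.1.trans_lt hy'.1, hy'.2⟩ hx'.1,
      hmarginal x' hx'B y' hy', hg_mono hx'.2.le]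
  refine ⟨hf₁, ?_⟩
  by_cases hlt : f₁ x y < f₁₂ x y
  · obtain ⟨w, hw⟩ := exists_between hb.2
    suffices f₁₂ x y - f₂ x y ≤ g x by linarith
    refine le_of_forall_mem_Ioo_right hx.2 (fun z hz => ?_) hg
    have hzB : z ∈ Ioo 0 B := ⟨hx.1.trans hz.1, hz.2⟩
    exact hmarginal z hzB w hw ▸ h.marginal₁ x hx y hy z hzB w ⟨hb.1.trans_lt hw.1, hw.2⟩ hz.1 hlt
      (hf₂ z hzB w hw)
  · linarith [h.nonneg₂ x hx y hy]

theorem eq_add_of_marginal_eq (h : CriticalValues B ε f₁ f₂ f₁₂) (hgap : HasNoGap B f₁ f₂ f₁₂)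
    {b : ℝ} (hb : b ∈ Ico 0 B) (hf₂ : ∀ x ∈ Ioo 0 B, ∀ y ∈ Ioo b B, 0 < f₂ x y) {g : ℝ → ℝ}
    (hg : Continuous g) (hg_mono : Monotone g)
    (hmarginal : ∀ x ∈ Ioo 0 B, ∀ y ∈ Ioo b B, f₁₂ x y - f₂ x y = g x) {x y : ℝ}
    (hx : x ∈ Ioo 0 B) (hy : y ∈ Ioo 0 B) (hpos : 0 < f₂ x y) : f₁₂ x y = f₂ x y + g x := by
  refine le_antisymm (h.le_add_of_marginal_eq hgap hb hf₂ hg hg_mono hmarginal x hx y hy).2 ?_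
  obtain ⟨w, hw⟩ := exists_between hb.2
  have hwB : w ∈ Ioo 0 B := ⟨hb.1.trans_lt hw.1, hw.2⟩
  suffices g x ≤ f₁₂ x y - f₂ x y by linarith
  refine le_of_forall_mem_Ioo_left hx.1 (fun z hz => ?_) hg
  have hzB : z ∈ Ioo 0 B := ⟨hz.1, hz.2.trans hx.2⟩
  exact hmarginal z hzB w hw ▸ h.marginal₁ z hzB w hwB x hx y hy hz.2
    (h.lt_of_hasNoGap hgap hb.1 hf₂ z hzB w hw) hpos

theorem isComparable_of_le_add (h : CriticalValues B ε f₁ f₂ f₁₂) {l d x₀ : ℝ} (hl : 0 ≤ l)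
    (hx₀ : x₀ ∈ Ioo 0 B) (hpos₁ : 0 < l * x₀ + d)
    (hle : ∀ x ∈ Ioo 0 B, ∀ y ∈ Ioo 0 B,
      f₁ x y ≤ max (l * x + d) 0 ∧ f₁₂ x y ≤ f₂ x y + max (l * x + d) 0)
    (heq : ∀ x ∈ Ioo 0 B, ∀ y ∈ Ioo 0 B, 0 < f₂ x y → f₁₂ x y = f₂ x y + max (l * x + d) 0) :
    IsComparable (ε / 2) 0 B x₀ B (fun y x => f₂ x y) (fun _ x => l * x + d) univ := by
  have hε := h.ε_pos
  have hsub : ∀ {x}, x ∈ Ioo x₀ B → x ∈ Ioo 0 B := fun hx => ⟨hx₀.1.trans hx.1, hx.2⟩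
  have hmax : ∀ {x}, x ∈ Ioo x₀ B → 0 < l * x + d ∧ max (l * x + d) 0 = l * x + d := by
    intro x hx
    have := mul_le_mul_of_nonneg_left hx.1.le hl
    exact ⟨by linarith, max_eq_left (by linarith)⟩
  refine
    { lt₁ := h.B_pos
      lt₂ := hx₀.2
      κ_pos := half_pos hε
      mono₁ := fun y hy x hx y' hy' x' hx' => h.mono₂ x (hsub hx) y hy x' (hsub hx') y' hy'
      mono₂ := fun _ _ _ _ _ _ _ _ _ => by gcongr
      subset_closure := by simp
      add_le_add := ?_ }
  intro y hy x hx y' hy' x' hx' _ _ hlt hpos hu hv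
  rw [lt_min_iff] at hv
  obtain ⟨hf₁, -⟩ := hle x (hsub hx) y hy
  obtain ⟨hf₁', hf₁₂'⟩ := hle x' (hsub hx') y' hy'
  have hf₁₂ := heq x (hsub hx) y hy hpos
  rw [(hmax hx).2] at hf₁ hf₁₂
  rw [(hmax hx').2] at hf₁' hf₁₂'
  have hadd' : f₁ x' y' + f₂ x' y' ≤ f₁₂ x' y' := by
    rcases (h.nonneg₂ x' (hsub hx') y' hy').eq_or_lt with hzero | hpos'
    · linarith [h.le₁ x' (hsub hx') y' hy']
    · linarith [heq x' (hsub hx') y' hy' hpos', (hmax hx').2]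
  linarith [h.mono₁₂ x (hsub hx) y hy x' (hsub hx') y' hy' (by linarith) (by linarith)
    (by linarith [(hmax hx).1]) (by linarith) (by linarith) (by linarith) (by linarith)]

theorem exists_eq_max_affine_of_le_add (h : CriticalValues B ε f₁ f₂ f₁₂) {l d x₀ : ℝ}
    (hl : 0 ≤ l) (hx₀ : x₀ ∈ Ioo 0 B) (hpos₁ : 0 < l * x₀ + d)
    (hle : ∀ x ∈ Ioo 0 B, ∀ y ∈ Ioo 0 B,
      f₁ x y ≤ max (l * x + d) 0 ∧ f₁₂ x y ≤ f₂ x y + max (l * x + d) 0)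
    (heq : ∀ x ∈ Ioo 0 B, ∀ y ∈ Ioo 0 B, 0 < f₂ x y → f₁₂ x y = f₂ x y + max (l * x + d) 0)
    (hpos₂ : ∃ x ∈ Ioo 0 B, ∃ y ∈ Ioo 0 B, 0 < f₂ x y) :
    ∃ c, ∀ x ∈ Ioo 0 B, ∀ y ∈ Ioo 0 B, f₂ x y = max (l * y + c) 0 := by
  have comparable := h.isComparable_of_le_add hl hx₀ hpos₁ hle heq
  have hsub : ∀ {x}, x ∈ Ioo x₀ B → x ∈ Ioo 0 B := fun hx => ⟨hx₀.1.trans hx.1, hx.2⟩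
  obtain ⟨x₁, hx₁⟩ := exists_between hx₀.2
  obtain ⟨b, hb, hthreshold⟩ := exists_threshold (P := fun y x => 0 < f₂ x y)
    (fun y hy x hx y' hy' x' hx' hlt hpos => hpos.trans_le (h.mono₂ x hx y hy x' hx' y' hy' hlt))
    (let ⟨x, hx, y, hy, hpos⟩ := hpos₂; ⟨y, hy, x, hx, hpos⟩)
  obtain ⟨y₁, hy₁⟩ := exists_between hb.2
  have hy₁B : y₁ ∈ Ioo 0 B := ⟨hb.1.trans_lt hy₁.1, hy₁.2⟩
  obtain ⟨l', -, c, d', hf₂⟩ := comparable.exists_eq_max_affine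
    (fun y hy x hx => h.nonneg₂ x (hsub hx) y hy)
    ⟨y₁, hy₁B, x₁, hx₁, (hthreshold y₁ hy₁B x₁ (hsub hx₁)).2 hy₁.1⟩
  obtain rfl : l = l' := (affine_unique hx₀.2 fun x hx => (hf₂ y₁ hy₁B x hx).2).1
  exact ⟨c, h.eq_of_eq_on_column (g := fun y => max (l * y + c) 0) (by fun_prop) subset_rfl
    (hsub hx₁) fun y hy => (hf₂ y hy x₁ hx₁).1⟩

theorem exists_hasAffineMarginal (h : CriticalValues B ε f₁ f₂ f₁₂) (hgap : HasNoGap B f₁ f₂ f₁₂)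
    (hpos₂ : ∃ x ∈ Ioo 0 B, ∃ y ∈ Ioo 0 B, 0 < f₂ x y) :
    (∀ x ∈ Ioo 0 B, ∀ y ∈ Ioo 0 B, f₁ x y = 0 ∧ f₁₂ x y = f₂ x y) ∨
      ∃ l c d, HasAffineMarginal B l c d f₁ f₂ f₁₂ := by
  obtain ⟨b, hb, hthreshold⟩ := exists_threshold (P := fun y x => 0 < f₂ x y)
    (fun y hy x hx y' hy' x' hx' hlt hpos => hpos.trans_le (h.mono₂ x hx y hy x' hx' y' hy' hlt))
    (let ⟨x, hx, y, hy, hpos⟩ := hpos₂; ⟨y, hy, x, hx, hpos⟩)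
  have hsub : ∀ {y}, y ∈ Ioo b B → y ∈ Ioo 0 B := fun hy => ⟨hb.1.trans_lt hy.1, hy.2⟩
  have hf₂ : ∀ x ∈ Ioo 0 B, ∀ y ∈ Ioo b B, 0 < f₂ x y :=
    fun x hx y hy => (hthreshold y (hsub hy) x hx).2 hy.1
  by_cases hlt : ∃ x ∈ Ioo 0 B, ∃ y ∈ Ioo b B, f₂ x y < f₁₂ x y
  · obtain ⟨l, hl, d, c, heq⟩ := h.exists_eq_max_affine_of_hasNoGap hgap hb hf₂ hlt
    have hg : Continuous fun x => max (l * x + d) 0 := by fun_prop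
    have hg_mono : Monotone fun x => max (l * x + d) 0 := fun _ _ _ => by dsimp only; gcongr
    have hmarginal := fun x hx y hy => (heq x hx y hy).1
    obtain ⟨x₀, hx₀, y₀, hy₀, hlt₀⟩ := hlt
    have hpos₁ : 0 < l * x₀ + d := by
      have := hmarginal x₀ hx₀ y₀ hy₀ ▸ sub_pos.2 hlt₀
      simpa using this
    have hf₁₂ : ∀ x ∈ Ioo 0 B, ∀ y ∈ Ioo 0 B, 0 < f₂ x y → f₁₂ x y = f₂ x y + max (l * x + d) 0 :=
      fun x hx y hy => h.eq_add_of_marginal_eq hgap hb hf₂ hg hg_mono hmarginal hx hy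
    obtain ⟨c', hf₂_eq⟩ := h.exists_eq_max_affine_of_le_add hl hx₀ hpos₁
      (h.le_add_of_marginal_eq hgap hb hf₂ hg hg_mono hmarginal) hf₁₂ hpos₂
    have hpos_y₀ : 0 < l * y₀ + c' := by
      have := hf₂_eq x₀ hx₀ y₀ (hsub hy₀) ▸ hf₂ x₀ hx₀ y₀ hy₀
      simpa using this
    refine Or.inr ⟨l, c', d, hl, ?_, ?_, hf₂_eq, fun x hx y hy hpos => ?_⟩
    · linarith [mul_le_mul_of_nonneg_left hx₀.2.le hl]
    · linarith [mul_le_mul_of_nonneg_left hy₀.2.le hl]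
    · have hf₂_pos := hf₂_eq x hx y hy
      rw [max_eq_left hpos.le] at hf₂_pos
      rw [hf₁₂ x hx y hy (hf₂_pos ▸ hpos), hf₂_pos]
  · push Not at hlt
    have hle := h.le_add_of_marginal_eq hgap hb hf₂ continuous_const monotone_const
      fun x hx y hy => sub_eq_zero.2 ((hlt x hx y hy).antisymm (h.le₂ x hx y (hsub hy)))
    refine Or.inl fun x hx y hy => ⟨(hle x hx y hy).1.antisymm (h.nonneg₁ x hx y hy), ?_⟩
    exact (add_zero (f₂ x y) ▸ (hle x hx y hy).2).antisymm (h.le₂ x hx y hy)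

end CriticalValues

namespace HasAffineMarginal

variable {B ε l c d : ℝ} {f₁ f₂ f₁₂ : ℝ → ℝ → ℝ}

theorem slope_pos (h : HasAffineMarginal B l c d f₁ f₂ f₁₂) {y : ℝ} (hyc : l * y + c ≤ 0) :
    0 < l := by
  refine h.nonneg.lt_of_ne' ?_
  rintro rfl
  linarith [h.pos₂]

theorem exists_zero (h : HasAffineMarginal B l c d f₁ f₂ f₁₂) {y : ℝ} (hy : 0 < y)
    (hyc : l * y + c ≤ 0) : ∃ b, 0 < b ∧ b < B ∧ y ≤ b ∧ l * b + c = 0 := by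
  have hl := h.slope_pos hyc
  have hb : l * (-c / l) + c = 0 := by field_simp; ring
  have hyb : y ≤ -c / l := le_of_mul_le_mul_left (by linarith) hl
  exact ⟨-c / l, hy.trans_le hyb, lt_of_mul_lt_mul_left (by linarith [h.pos₂]) hl.le, hyb, hb⟩

theorem both_le_of_add_lt (hM : HasAffineMarginal B l c d f₁ f₂ f₁₂)
    (h : CriticalValues B ε f₁ f₂ f₁₂) {x y w z : ℝ} (hx : x ∈ Ioo 0 B) (hy : y ∈ Ioo 0 B)
    (hw : w ∈ Ioo 0 B) (hz : z ∈ Ioo 0 B) (hlt : x + y < w + z) (hf₁ : f₁ x y = 0)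
    (hf₂ : f₂ x y = 0) (hpos : 0 < l * z + c) (hε : l * z + c < ε) (hf₁w : f₁ w z < ε) :
    f₁₂ x y ≤ l * z + c + max (l * w + d) 0 := by
  have hf₂w := hM.eq₂ w hw z hz
  rw [max_eq_left hpos.le] at hf₂w
  rw [← hM.eq₁₂ w hw z hz hpos]
  rcases le_or_gt (f₁₂ x y) 0 with hle | hlt₁₂
  · exact hle.trans ((h.nonneg₁ w hw z hz).trans (h.le₁ w hw z hz))
  · exact h.mono₁₂ x hx y hy w hw z hz hlt (by linarith) (by linarith) (by linarith) (by linarith)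
      (by linarith) (by linarith [h.le₁ w hw z hz])

theorem both_le_of_inactive (hM : HasAffineMarginal B l c d f₁ f₂ f₁₂)
    (h : CriticalValues B ε f₁ f₂ f₁₂) {c₁ : ℝ} (hc : c₁ ≤ c)
    (hf₁ : ∀ x ∈ Ioo 0 B, ∀ y ∈ Ioo 0 B, f₁ x y = max (l * x + c₁) 0) {x y : ℝ} (hx : x ∈ Ioo 0 B)
    (hy : y ∈ Ioo 0 B) (hxc : l * x + c₁ ≤ 0) (hyc : l * y + c ≤ 0) :
    f₁₂ x y ≤ max (max (l * (x + y) + c) 0 + d) 0 := by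
  obtain ⟨b, hb, hbB, hyb, hbc⟩ := hM.exists_zero hy.1 hyc
  refine le_of_forall_pos_le_add fun η hη => ?_
  obtain ⟨e, he, heB, hle⟩ := exists_pos_lt_mul_lt hM.nonneg (lt_min (sub_pos.2 hbB) hb)
    (lt_min (half_pos hη) h.ε_pos)
  rw [lt_min_iff] at heB hle
  have hle_pos := mul_pos (hM.slope_pos hyc) he
  obtain ⟨w, hw, hw_lt, hlw, hlw_c₁⟩ : ∃ w ∈ Ioo 0 B, x + y < w + (b + e) ∧
      l * w ≤ max (l * (x + y) + c) 0 + l * e ∧ l * w + c₁ ≤ l * e := by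
    rcases le_total (x + y - b - e / 2) (e / 2) with hle_e | hle_e
    · refine ⟨e / 2, ⟨by linarith, by linarith⟩, by linarith, ?_, ?_⟩
      · linarith [le_max_right (l * (x + y) + c) 0]
      · linarith [mul_pos (hM.slope_pos hyc) hb]
    · refine ⟨x + y - b - e / 2, ⟨by linarith, by linarith [hx.2]⟩, by linarith, ?_, ?_⟩
      · linarith [le_max_left (l * (x + y) + c) 0]
      · linarith [mul_le_mul_of_nonneg_left hyb hM.nonneg]
  have hz : b + e ∈ Ioo 0 B := ⟨by linarith, by linarith⟩
  have hle_both := hM.both_le_of_add_lt h hx hy hw hz hw_lt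
    ((hf₁ x hx y hy).trans (max_eq_right hxc)) ((hM.eq₂ x hx y hy).trans (max_eq_right hyc))
    (by linarith) (by linarith)
    ((hf₁ w hw _ hz).trans_lt (max_lt (by linarith) h.ε_pos))
  have hmax : max (l * w + d) 0 ≤ max (max (l * (x + y) + c) 0 + d) 0 + l * e :=
    max_le (by linarith [le_max_left (max (l * (x + y) + c) 0 + d) 0])
      (by linarith [le_max_right (max (l * (x + y) + c) 0 + d) 0])
  linarith

theorem le_both_of_inactive (hM : HasAffineMarginal B l c d f₁ f₂ f₁₂)
    (h : CriticalValues B ε f₁ f₂ f₁₂) {c₁ : ℝ}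
    (hf₁ : ∀ x ∈ Ioo 0 B, ∀ y ∈ Ioo 0 B, f₁ x y = max (l * x + c₁) 0) {x y : ℝ} (hx : x ∈ Ioo 0 B)
    (hy : y ∈ Ioo 0 B) (hxc : l * x + c₁ ≤ 0) (hyc : l * y + c ≤ 0)
    (hpos : 0 < l * (x + y) + c) : l * (x + y) + (c + d) ≤ f₁₂ x y := by
  rcases le_or_gt (l * (x + y) + (c + d)) 0 with hneg | hpos_d
  · exact hneg.trans ((h.nonneg₁ x hx y hy).trans (h.le₁ x hx y hy))
  have hl := hM.slope_pos hyc
  obtain ⟨b, hb, hbB, hyb, hbc⟩ := hM.exists_zero hy.1 hyc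
  have hbxy : b < x + y := lt_of_mul_lt_mul_left (by linarith) hM.nonneg
  refine le_of_forall_pos_le_add fun η hη => ?_
  obtain ⟨e, he, heB, hle⟩ := exists_pos_lt_mul_lt hM.nonneg
    (lt_min (sub_pos.2 hbB) (half_pos (sub_pos.2 hbxy)))
    (lt_min hη (lt_min (half_pos hpos_d) h.ε_pos))
  rw [lt_min_iff] at heB hle
  rw [lt_min_iff] at hle
  have hle_pos := mul_pos hl he
  have hwI : x + y - b - 2 * e ∈ Ioo 0 B := ⟨by linarith, by linarith [hx.2]⟩
  have hzI : b + e ∈ Ioo 0 B := ⟨by linarith, by linarith⟩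
  have hlz : l * (b + e) + c = l * e := by linarith
  have hf₁_zero := hf₁ x hx y hy
  have hf₂_zero := hM.eq₂ x hx y hy
  have hf₁w := hf₁ _ hwI _ hzI
  have hf₂w := hM.eq₂ _ hwI _ hzI
  have hf₁₂w := hM.eq₁₂ _ hwI _ hzI (by rwa [hlz])
  rw [max_eq_right (by linarith)] at hf₁_zero hf₂_zero hf₁w
  rw [hlz, max_eq_left hle_pos.le] at hf₂w
  rw [hlz, max_eq_left (by linarith)] at hf₁₂w
  have hmono := h.mono₁₂ _ hwI _ hzI x hx y hy (by linarith) (by linarith) (by linarith)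
    (by linarith) (by linarith) (by linarith)
    (by linarith [h.le₁ x hx y hy, h.nonneg₁ x hx y hy, h.ε_pos])
  linarith

theorem isAffineAt (hM : HasAffineMarginal B l c d f₁ f₂ f₁₂) (h : CriticalValues B ε f₁ f₂ f₁₂)
    {c₁ : ℝ} (hc : c₁ ≤ c) (hf₁ : ∀ x ∈ Ioo 0 B, ∀ y ∈ Ioo 0 B, f₁ x y = max (l * x + c₁) 0)
    (hf₁₂ : ∀ x ∈ Ioo 0 B, ∀ y ∈ Ioo 0 B, 0 < l * x + c₁ →
      f₁₂ x y = max (l * (x + y) + (c + d)) (l * x + c₁)) {x y : ℝ} (hx : x ∈ Ioo 0 B)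
    (hy : y ∈ Ioo 0 B) (hd : l * (x + y) + c ≤ 0 → d < 0) :
    IsAffineAt l c₁ c (c + d) f₁ f₂ f₁₂ x y := by
  refine h.isAffineAt_of_le hx hy (hf₁ x hx y hy) (hM.eq₂ x hx y hy) ?_ fun hlt₁ hlt₂ => ?_
  · rcases lt_or_ge 0 (l * y + c) with hyc | hyc
    · linarith [hM.eq₁₂ x hx y hy hyc, le_max_left (l * x + d) 0]
    rcases lt_or_ge 0 (l * x + c₁) with hxc | hxc
    · exact hf₁₂ x hx y hy hxc ▸ le_max_left _ _
    rcases lt_or_ge 0 (l * (x + y) + c) with hpos | hneg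
    · exact hM.le_both_of_inactive h hf₁ hx hy hxc hyc hpos
    · linarith [hd hneg, h.nonneg₁ x hx y hy, h.le₁ x hx y hy]
  · rw [hf₁ x hx y hy, max_lt_iff] at hlt₁
    rw [hM.eq₂ x hx y hy, max_lt_iff] at hlt₂
    rcases lt_or_ge 0 (l * y + c) with hyc | hyc
    · have heq := hM.eq₁₂ x hx y hy hyc
      rcases max_choice (l * x + d) 0 with hmax | hmax <;> rw [hmax] at heq <;> linarith
    rcases lt_or_ge 0 (l * x + c₁) with hxc | hxc
    · have heq := hf₁₂ x hx y hy hxc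
      rcases max_choice (l * (x + y) + (c + d)) (l * x + c₁) with hmax | hmax <;>
        rw [hmax] at heq <;> linarith
    have hle := hM.both_le_of_inactive h hc hf₁ hx hy hxc hyc
    rcases le_max_iff.1 hle with hle | hle
    · rcases lt_or_ge 0 (l * (x + y) + c) with hpos | hneg
      · rw [max_eq_left hpos.le] at hle
        linarith
      · rw [max_eq_right hneg] at hle
        linarith [hd hneg]
    · linarith

theorem isClassified (hM : HasAffineMarginal B l c d f₁ f₂ f₁₂) (h : CriticalValues B ε f₁ f₂ f₁₂)
    {c₁ : ℝ} (hc : c₁ ≤ c) (hf₁ : ∀ x ∈ Ioo 0 B, ∀ y ∈ Ioo 0 B, f₁ x y = max (l * x + c₁) 0)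
    (hf₁₂ : ∀ x ∈ Ioo 0 B, ∀ y ∈ Ioo 0 B, 0 < l * x + c₁ →
      f₁₂ x y = max (l * (x + y) + (c + d)) (l * x + c₁)) : IsClassified B f₁ f₂ f₁₂ := by
  have hl := hM.nonneg
  by_cases htail : d < 0 ∨ 0 ≤ c
  · refine Or.inl ⟨l, c₁, c, c + d, hl, fun x hx y hy =>
      hM.isAffineAt h hc hf₁ hf₁₂ hx hy fun hneg => htail.resolve_right fun hc₀ => ?_⟩
    have := mul_pos (hM.slope_pos hneg) (add_pos hx.1 hy.1)
    linarith
  · push Not at htail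
    obtain ⟨hd, hc₀⟩ := htail
    have hl' : 0 < l := hM.slope_pos (y := 0) (by linarith)
    have hD : l * (-c / l) = -c := by field_simp
    refine Or.inr (Or.inl ⟨l, c₁, c, c + d, -c / l, hl', div_pos (neg_pos.2 hc₀) hl', ?_, ?_,
      fun x hx y hy => ⟨fun hlt => ?_, fun hle => ?_⟩⟩)
    · linarith
    · rw [hD, neg_neg, max_eq_right hc]
    · have := mul_lt_mul_of_pos_left hlt hl'
      exact hM.isAffineAt h hc hf₁ hf₁₂ hx hy fun hneg => by linarith
    · have hxy := mul_le_mul_of_nonneg_left hle hl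
      have hlx := mul_nonneg hl hx.1.le
      have hly := mul_nonneg hl hy.1.le
      have hxc : l * x + c₁ ≤ 0 := by linarith
      have hyc : l * y + c ≤ 0 := by linarith
      have hle := hM.both_le_of_inactive h hc hf₁ hx hy hxc hyc
      rw [max_eq_right (a := l * (x + y) + c) (by linarith), zero_add, max_eq_left hd] at hle
      exact ⟨by rw [hf₁ x hx y hy, max_eq_right hxc], by rw [hM.eq₂ x hx y hy, max_eq_right hyc],
        by linarith⟩

theorem eventually_both_eq (hM : HasAffineMarginal B l c d f₁ f₂ f₁₂) (hB : 0 < B) :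
    ∀ᶠ z in 𝓝[<] B, f₁₂ z z = 2 * l * z + (c + d) := by
  have hcont : ∀ a, ContinuousWithinAt (fun z => l * z + a) (Iio B) B :=
    fun a => Continuous.continuousWithinAt (by fun_prop)
  filter_upwards [Ioo_mem_nhdsLT hB, (hcont c).eventually_const_lt hM.pos₂,
    (hcont d).eventually_const_lt hM.pos₁] with z hz hzc hzd
  rw [hM.eq₁₂ z hz z hz hzc, max_eq_left hzd.le]
  ring

theorem constants_eq_of_swap (hM : HasAffineMarginal B l c d f₁ f₂ f₁₂) {l' c' d' : ℝ} (hB : 0 < B)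
    (hM' : HasAffineMarginal B l' c' d' (fun x y => f₂ y x) (fun x y => f₁ y x)
      (fun x y => f₁₂ y x)) : l = l' ∧ c + d = c' + d' := by
  obtain ⟨a, haB, ha⟩ := mem_nhdsLT_iff_exists_Ioo_subset.1
    ((hM.eventually_both_eq hB).and (hM'.eventually_both_eq hB))
  have heq := affine_unique haB fun z hz => (ha hz).1.symm.trans (ha hz).2
  exact ⟨by linarith [heq.1], heq.2⟩

theorem isClassified_of_swap (hM : HasAffineMarginal B l c d f₁ f₂ f₁₂)
    (h : CriticalValues B ε f₁ f₂ f₁₂) {c' d' : ℝ}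
    (hM' : HasAffineMarginal B l c' d' (fun x y => f₂ y x) (fun x y => f₁ y x)
      (fun x y => f₁₂ y x)) (hcd : c + d = c' + d') (hc : c' ≤ c) : IsClassified B f₁ f₂ f₁₂ := by
  refine hM.isClassified h hc (fun x hx y hy => hM'.eq₂ y hy x hx) fun x hx y hy hpos => ?_
  rw [hM'.eq₁₂ y hy x hx hpos, hcd, add_comm (l * x + c'), max_add]
  congr 1 <;> ring

theorem isClassified_of_eq_zero (hM : HasAffineMarginal B l c d f₁ f₂ f₁₂)
    (h : CriticalValues B ε f₁ f₂ f₁₂) (hf₁ : ∀ x ∈ Ioo 0 B, ∀ y ∈ Ioo 0 B, f₁ x y = 0) :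
    IsClassified B f₁ f₂ f₁₂ := by
  have hneg : ∀ x ∈ Ioo 0 B, l * x + -(l * B) ≤ 0 := fun x hx => by
    linarith [mul_le_mul_of_nonneg_left hx.2.le hM.nonneg]
  exact hM.isClassified h (c₁ := -(l * B)) (by linarith [hM.pos₂])
    (fun x hx y hy => (hf₁ x hx y hy).trans (max_eq_right (hneg x hx)).symm)
    fun x hx _ _ hpos => absurd (hneg x hx) hpos.not_ge

end HasAffineMarginal

namespace CriticalValues

variable {B ε : ℝ} {f₁ f₂ f₁₂ : ℝ → ℝ → ℝ}

theorem eq_zero_or_exists_pos (h : CriticalValues B ε f₁ f₂ f₁₂) :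
    (∀ x ∈ Ioo 0 B, ∀ y ∈ Ioo 0 B, f₂ x y = 0) ∨ ∃ x ∈ Ioo 0 B, ∃ y ∈ Ioo 0 B, 0 < f₂ x y := by
  refine or_iff_not_imp_right.2 fun hpos x hx y hy => ?_
  push Not at hpos
  exact (hpos x hx y hy).antisymm (h.nonneg₂ x hx y hy)

theorem isClassified_of_pos (h : CriticalValues B ε f₁ f₂ f₁₂) (hgap : HasNoGap B f₁ f₂ f₁₂)
    (hpos : ∃ x ∈ Ioo 0 B, ∃ y ∈ Ioo 0 B, 0 < f₂ x y) : IsClassified B f₁ f₂ f₁₂ := by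
  rcases h.exists_hasAffineMarginal hgap hpos with hzero₁ | ⟨l, c, d, hM⟩
  · exact Or.inr (Or.inr (Or.inr (Or.inl hzero₁)))
  rcases h.swap.eq_zero_or_exists_pos with hzero₁ | hpos₁
  · exact hM.isClassified_of_eq_zero h fun x hx y hy => hzero₁ y hy x hx
  rcases h.swap.exists_hasAffineMarginal hgap.swap hpos₁ with hzero₂ | ⟨l', c', d', hM'⟩
  · exact Or.inr (Or.inr (Or.inr (Or.inr fun x hx y hy => hzero₂ y hy x hx)))
  obtain ⟨rfl, hcd⟩ := hM.constants_eq_of_swap h.B_pos hM'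
  rcases le_total c' c with hc | hc
  · exact hM.isClassified_of_swap h hM' hcd hc
  · exact (hM'.isClassified_of_swap h.swap hM hcd.symm hc).swap

theorem isClassified_of_hasNoGap (h : CriticalValues B ε f₁ f₂ f₁₂)
    (hgap : HasNoGap B f₁ f₂ f₁₂) : IsClassified B f₁ f₂ f₁₂ := by
  rcases h.eq_zero_or_exists_pos with hzero₂ | hpos₂
  · rcases h.swap.eq_zero_or_exists_pos with hzero₁ | hpos₁
    · exact Or.inr (Or.inr (Or.inl fun x hx y hy => ⟨hzero₁ y hy x hx, hzero₂ x hx y hy⟩))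
    · exact (h.swap.isClassified_of_pos hgap.swap hpos₁).swap
  · exact h.isClassified_of_pos hgap hpos₂

theorem isClassified (h : CriticalValues B ε f₁ f₂ f₁₂) : IsClassified B f₁ f₂ f₁₂ := by
  by_cases hgap : ∃ κ p q r s, IsGap B κ p q r s f₁ f₂ f₁₂
  · obtain ⟨κ, p, q, r, s, hgap⟩ := hgap
    exact Or.inl (h.isAffineForm_of_gap hgap)
  · exact h.isClassified_of_hasNoGap fun κ p q r s hκ => hgap ⟨κ, p, q, r, s, hκ⟩

end CriticalValues

/-- A set of monotone valuations described by a condition on the excess `x₁ + x₂ - x₁₂`: with a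
point of excess `e` it contains all monotone valuations whose excess lies between `0` and `e`, or
slightly above. This is what the four domains of the theorem have in common. -/
structure IsExcessDomain (V : Set Bid) : Prop where
  subset_monotoneVals : V ⊆ monotoneVals
  exists_forall_mem : ∀ {x y z}, (x, y, z) ∈ V → ∃ δ > 0, ∀ x' y' z',
    (x', y', z') ∈ monotoneVals → min (x + y - z) 0 ≤ x' + y' - z' →
    x' + y' - z' < max (x + y - z) 0 + δ → (x', y', z') ∈ V

/-- The bundle after renaming the tasks. -/
def swapTasks : Bundle → Bundle
  | .empty => .empty
  | .one => .two
  | .two => .one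
  | .both => .both

/-- The bid after renaming the tasks. -/
def swapBid (t : Bid) : Bid := (t.2.1, t.1, t.2.2)

theorem swapTasks_eq_iff {α β : Bundle} : swapTasks α = β ↔ α = swapTasks β := by
  cases α <;> cases β <;> simp [swapTasks]

theorem cost_swapTasks (t : Bid) (α : Bundle) : cost t (swapTasks α) = cost (swapBid t) α := by
  cases α <;> rfl

namespace IsExcessDomain

variable {V : Set Bid} {x y z r : ℝ}

theorem monotone (hV : IsExcessDomain V) (ht : (x, y, z) ∈ V) :
    0 ≤ x ∧ 0 ≤ y ∧ x ≤ z ∧ y ≤ z :=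
  hV.subset_monotoneVals ht

theorem preimage_swapBid (hV : IsExcessDomain V) : IsExcessDomain (swapBid ⁻¹' V) where
  subset_monotoneVals := fun _ ht =>
    have ⟨h₂, h₁, h₂', h₁'⟩ := hV.subset_monotoneVals ht
    ⟨h₁, h₂, h₁', h₂'⟩
  exists_forall_mem := by
    intro x y z ht
    obtain ⟨δ, hδ, hmem⟩ := hV.exists_forall_mem ht
    refine ⟨δ, hδ, fun x' y' z' ⟨h₁, h₂, h₁', h₂'⟩ hle hlt =>
      hmem y' x' z' ⟨h₂, h₁, h₂', h₁'⟩ ?_ ?_⟩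
    · rwa [add_comm y x, add_comm y' x']
    · rwa [add_comm y x, add_comm y' x']

theorem exists_forall_mem_of_nonneg (hV : IsExcessDomain V) (ht : (x, y, z) ∈ V) :
    ∃ δ > 0, ∀ x' y' z', (x', y', z') ∈ monotoneVals → 0 ≤ x' + y' - z' →
      x' + y' - z' < max (x + y - z) 0 + δ → (x', y', z') ∈ V := by
  obtain ⟨δ, hδ, hmem⟩ := hV.exists_forall_mem ht
  exact ⟨δ, hδ, fun x' y' z' hmono hle => hmem x' y' z' hmono ((min_le_right _ _).trans hle)⟩

theorem eventually_exists_mem_above (hV : IsExcessDomain V) (ht : (x, y, z) ∈ V) (hr : 0 < r)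
    (hrx : r ≤ x) : ∀ᶠ η in 𝓝[>] 0, ∃ y' > y, (r - η, y', z + 2 * η) ∈ V := by
  obtain ⟨-, -, hxz, hyz⟩ := hV.monotone ht
  obtain ⟨δ, hδ, hmem⟩ := hV.exists_forall_mem_of_nonneg ht
  filter_upwards [Ioo_mem_nhdsGT (lt_min hδ hr)] with η ⟨hη, hηlt⟩
  obtain ⟨hηδ, hηr⟩ := lt_min_iff.1 hηlt
  refine ⟨min (max y (z - r) + 4 * η) (z + 2 * η), ?_, hmem _ _ _ ⟨?_, ?_, ?_, ?_⟩ ?_ ?_⟩ <;> grind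

theorem eventually_exists_mem_below (hV : IsExcessDomain V) (ht : (x, y, z) ∈ V) (hr : 0 ≤ r)
    (hrx : r < x) :
    ∀ᶠ η in 𝓝[>] 0, ∃ y', min y (z - η) ≤ y' ∧ (r + η, y', z - η) ∈ V := by
  obtain ⟨-, hy, hxz, -⟩ := hV.monotone ht
  obtain ⟨δ, hδ, hmem⟩ := hV.exists_forall_mem_of_nonneg ht
  filter_upwards [Ioo_mem_nhdsGT (lt_min (half_pos hδ) (half_pos (sub_pos.2 hrx)))]
    with η ⟨hη, hηlt⟩
  obtain ⟨hηδ, hηr⟩ := lt_min_iff.1 hηlt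
  refine ⟨min (max y (z - r)) (z - η), ?_, hmem _ _ _ ⟨?_, ?_, ?_, ?_⟩ ?_ ?_⟩ <;> grind

theorem eventually_exists_mem_diagonal (hV : IsExcessDomain V) (ht : (x, y, z) ∈ V) {q : ℝ}
    (hq : 0 ≤ q) (hyq : y ≤ q) (hlt : r - q < x - y) (hlt' : r - q < z - y)
    (hyz : y < z) :
    ∀ᶠ η in 𝓝[>] 0, ∃ x' y', (x', y', z - y + y' - η) ∈ V ∧ y' ≤ q ∧ r - q < x' - y' ∧
      (x' - y' ≤ r - q + η ∨ y' = q) := by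
  obtain ⟨-, hy, -, -⟩ := hV.monotone ht
  obtain ⟨δ, hδ, hmem⟩ := hV.exists_forall_mem_of_nonneg ht
  filter_upwards [Ioo_mem_nhdsGT (lt_min (lt_min (half_pos hδ) (sub_pos.2 hyz))
    (half_pos (sub_pos.2 hlt')))] with η ⟨hη, hηlt⟩
  obtain ⟨hηlt, hη₃⟩ := lt_min_iff.1 hηlt
  obtain ⟨hη₁, hη₂⟩ := lt_min_iff.1 hηlt
  rcases le_or_gt (z - y) (r + 2 * η) with hle | hgt
  · refine ⟨max y (z - y - (r - q) - 2 * η) + (r - q) + η, max y (z - y - (r - q) - 2 * η),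
      hmem _ _ _ ⟨?_, ?_, ?_, ?_⟩ ?_ ?_, ?_, ?_, Or.inl ?_⟩ <;> grind
  · refine ⟨z - y - η, q, hmem _ _ _ ⟨?_, ?_, ?_, ?_⟩ ?_ ?_, le_rfl, ?_, Or.inr rfl⟩ <;> grind

end IsExcessDomain

/-- `f₁` and `f₂` are critical values of the bundles `1` and `2` against `∅` for the weakly
monotone rule `a` of a single player on the domain `V`. -/
structure IsSingleTaskPrice (V : Set Bid) (a : Bid → Bundle) (f₁ f₂ : ℝ) : Prop where
  domain : IsExcessDomain V
  wmon : ∀ t ∈ V, ∀ t' ∈ V, cost t (a t) - cost t (a t') ≤ cost t' (a t) - cost t' (a t')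
  nonneg₁ : 0 ≤ f₁
  nonneg₂ : 0 ≤ f₂
  le_of_empty₁ : ∀ {x y z}, (x, y, z) ∈ V → a (x, y, z) = .empty → f₁ ≤ x
  le_of_empty₂ : ∀ {x y z}, (x, y, z) ∈ V → a (x, y, z) = .empty → f₂ ≤ y
  le_of_one : ∀ {x y z}, (x, y, z) ∈ V → a (x, y, z) = .one → x ≤ f₁
  le_of_two : ∀ {x y z}, (x, y, z) ∈ V → a (x, y, z) = .two → y ≤ f₂
  exists_one : ∀ r, 0 ≤ r → r < f₁ → ∃ x y z, (x, y, z) ∈ V ∧ a (x, y, z) = .one ∧ r < x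
  exists_two : ∀ r, 0 ≤ r → r < f₂ → ∃ x y z, (x, y, z) ∈ V ∧ a (x, y, z) = .two ∧ r < y

/-- `p` is a list of critical values, or prices, of the bundles for the allocation rule `a` of a
single player: at every bid `t` the rule minimizes the cost minus the price. -/
def IsPrice (V : Set Bid) (a : Bid → Bundle) (p : Bid) : Prop :=
  p ∈ monotoneVals ∧ ∀ t ∈ V, ∀ α, cost t (a t) - cost p (a t) ≤ cost t α - cost p α

/-- The values forced on the price of `12` from below: `f₁` and `f₂`, and the values that make
`12` at least as good as each other bundle at every bid which receives `12`. -/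
def lowerPrices (V : Set Bid) (a : Bid → Bundle) (f₁ f₂ : ℝ) : Set ℝ :=
  {f₁, f₂} ∪ {r | ∃ u v w, (u, v, w) ∈ V ∧ a (u, v, w) = .both ∧
    (r = w ∨ r = f₁ + w - u ∨ r = f₂ + w - v)}

theorem cost_sub_cost_le_of_wmon {V : Set Bid} {a : Bid → Bundle}
    (hw : ∀ t ∈ V, ∀ t' ∈ V, cost t (a t) - cost t (a t') ≤ cost t' (a t) - cost t' (a t'))
    {t t' : Bid} {α β : Bundle} (ht : t ∈ V) (ht' : t' ∈ V) (hα : a t = α) (hβ : a t' = β) :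
    cost t α - cost t β ≤ cost t' α - cost t' β := by
  subst hα hβ
  exact hw t ht t' ht'

namespace IsSingleTaskPrice

variable {V : Set Bid} {a : Bid → Bundle} {f₁ f₂ x y z u v w : ℝ}

theorem swap (S : IsSingleTaskPrice V a f₁ f₂) :
    IsSingleTaskPrice (swapBid ⁻¹' V) (fun t => swapTasks (a (swapBid t))) f₂ f₁ where
  domain := S.domain.preimage_swapBid
  wmon t ht t' ht' := by simpa only [cost_swapTasks] using S.wmon _ ht _ ht'
  nonneg₁ := S.nonneg₂
  nonneg₂ := S.nonneg₁
  le_of_empty₁ ht ha := S.le_of_empty₂ ht (swapTasks_eq_iff.1 ha)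
  le_of_empty₂ ht ha := S.le_of_empty₁ ht (swapTasks_eq_iff.1 ha)
  le_of_one ht ha := S.le_of_two ht (swapTasks_eq_iff.1 ha)
  le_of_two ht ha := S.le_of_one ht (swapTasks_eq_iff.1 ha)
  exists_one r hr hlt :=
    have ⟨x, y, z, ht, ha, hr⟩ := S.exists_two r hr hlt
    ⟨y, x, z, ht, swapTasks_eq_iff.2 ha, hr⟩
  exists_two r hr hlt :=
    have ⟨x, y, z, ht, ha, hr⟩ := S.exists_one r hr hlt
    ⟨y, x, z, ht, swapTasks_eq_iff.2 ha, hr⟩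

theorem le_of_empty_of_both (S : IsSingleTaskPrice V a f₁ f₂) (ht : (x, y, z) ∈ V)
    (h0 : a (x, y, z) = .empty) (hu : (u, v, w) ∈ V) (h12 : a (u, v, w) = .both) : w ≤ z := by
  simpa [cost] using cost_sub_cost_le_of_wmon S.wmon ht hu h0 h12

theorem sub_le_of_one_of_two (S : IsSingleTaskPrice V a f₁ f₂) (ht : (x, y, z) ∈ V)
    (h1 : a (x, y, z) = .one) (hu : (u, v, w) ∈ V) (h2 : a (u, v, w) = .two) :
    x - y ≤ u - v :=
  cost_sub_cost_le_of_wmon S.wmon ht hu h1 h2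

theorem sub_le_of_one_of_both (S : IsSingleTaskPrice V a f₁ f₂) (ht : (x, y, z) ∈ V)
    (h1 : a (x, y, z) = .one) (hu : (u, v, w) ∈ V) (h12 : a (u, v, w) = .both) :
    w - u ≤ z - x := by
  simpa [cost] using neg_le_neg (cost_sub_cost_le_of_wmon S.wmon ht hu h1 h12)

theorem sub_le_of_two_of_both (S : IsSingleTaskPrice V a f₁ f₂) (ht : (x, y, z) ∈ V)
    (h2 : a (x, y, z) = .two) (hu : (u, v, w) ∈ V) (h12 : a (u, v, w) = .both) :
    w - v ≤ z - y :=
  S.swap.sub_le_of_one_of_both (x := y) (y := x) (u := v) (v := u) ht (swapTasks_eq_iff.2 h2) hu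
    (swapTasks_eq_iff.2 h12)

theorem sub_price_one_le_sub_price_two (S : IsSingleTaskPrice V a f₁ f₂) (ht : (x, y, z) ∈ V)
    (h1 : a (x, y, z) = .one) : x - f₁ ≤ y - f₂ := by
  by_contra! hlt
  obtain ⟨hx, hy, hxz, hyz⟩ := S.domain.monotone ht
  have hxf := S.le_of_one ht h1
  obtain ⟨u, v, w, hu, hu2, huv⟩ := S.exists_two (y + (f₁ - x)) (by linarith) (by linarith)
  obtain ⟨δ, hδ, hmem⟩ := S.domain.exists_forall_mem ht
  obtain ⟨η, hη, hη'⟩ := exists_between (show 0 < (v - (y + (f₁ - x))) / 3 by linarith)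
  have hmem := hmem (f₁ + η) (y + (f₁ - x) + 2 * η) (z + 2 * (f₁ - x) + 3 * η)
    ⟨by linarith, by linarith, by linarith, by linarith⟩ (by linarith [min_le_left (x + y - z) 0])
    (by linarith [le_max_left (x + y - z) 0])
  -- Shifted along the diagonal until task `1` costs slightly more than `f₁`, the bid still has task
  -- `2` below `f₂`, so that no bundle is left for it.
  cases ha : a (f₁ + η, y + (f₁ - x) + 2 * η, z + 2 * (f₁ - x) + 3 * η) with
  | empty => linarith [S.le_of_empty₂ hmem ha, S.le_of_two hu hu2]
  | one => linarith [S.le_of_one hmem ha]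
  | two => linarith [S.sub_le_of_one_of_two ht h1 hmem ha]
  | both => linarith [S.sub_le_of_one_of_both ht h1 hmem ha]

theorem sub_price_two_le_sub_price_one (S : IsSingleTaskPrice V a f₁ f₂) (ht : (x, y, z) ∈ V)
    (h2 : a (x, y, z) = .two) : y - f₂ ≤ x - f₁ :=
  S.swap.sub_price_one_le_sub_price_two (x := y) (y := x) ht (swapTasks_eq_iff.2 h2)

theorem price_one_add_sub_le_of_empty (S : IsSingleTaskPrice V a f₁ f₂) (ht : (x, y, z) ∈ V)
    (h0 : a (x, y, z) = .empty) (hu : (u, v, w) ∈ V) (h12 : a (u, v, w) = .both) :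
    f₁ + w - u ≤ z := by
  by_contra! hlt
  have hu0 := (S.domain.monotone hu).1
  have hwz := S.le_of_empty_of_both ht h0 hu h12
  obtain ⟨η, ⟨y', hy', hmem⟩, hη, hη'⟩ := ((S.domain.eventually_exists_mem_above ht
    (show 0 < f₁ by linarith) (S.le_of_empty₁ ht h0)).and
    (Ioo_mem_nhdsGT (show 0 < (f₁ + w - u - z) / 4 by linarith))).exists
  cases ha : a (f₁ - η, y', z + 2 * η) with
  | empty => linarith [S.le_of_empty₁ hmem ha]
  | one => linarith [S.sub_le_of_one_of_both hmem ha hu h12]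
  | two => linarith [S.le_of_two hmem ha, S.le_of_empty₂ ht h0]
  | both => linarith [S.le_of_empty_of_both ht h0 hmem ha]

theorem sub_price_one_le_of_one (S : IsSingleTaskPrice V a f₁ f₂) (ht : (x, y, z) ∈ V)
    (h1 : a (x, y, z) = .one) (hu : (u, v, w) ∈ V) (h12 : a (u, v, w) = .both) :
    w - f₁ ≤ z - x := by
  by_contra! hlt
  have hyz := (S.domain.monotone ht).2.2.2
  have hwu := S.sub_le_of_one_of_both ht h1 hu h12
  have hxy := S.sub_price_one_le_sub_price_two ht h1
  obtain ⟨η, ⟨y', hy', hmem⟩, hη, hη'⟩ := ((S.domain.eventually_exists_mem_below hu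
    S.nonneg₁ (show f₁ < u by linarith)).and
    (Ioo_mem_nhdsGT (show 0 < (w - f₁ - (z - x)) / 4 by linarith))).exists
  cases ha : a (f₁ + η, y', w - η) with
  | empty => linarith [S.le_of_empty_of_both hmem ha hu h12]
  | one => linarith [S.le_of_one hmem ha]
  | two =>
    rcases min_le_iff.1 hy' with hv | hw
    · linarith [S.sub_le_of_two_of_both hmem ha hu h12]
    · linarith [S.le_of_two hmem ha]
  | both => linarith [S.sub_le_of_one_of_both ht h1 hmem ha]

theorem price_two_add_sub_le_of_empty (S : IsSingleTaskPrice V a f₁ f₂) (ht : (x, y, z) ∈ V)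
    (h0 : a (x, y, z) = .empty) (hu : (u, v, w) ∈ V) (h12 : a (u, v, w) = .both) :
    f₂ + w - v ≤ z :=
  S.swap.price_one_add_sub_le_of_empty (x := y) (y := x) (u := v) (v := u) ht
    (swapTasks_eq_iff.2 h0) hu (swapTasks_eq_iff.2 h12)

theorem sub_add_price_two_sub_price_one_le_of_one (S : IsSingleTaskPrice V a f₁ f₂)
    (ht : (x, y, z) ∈ V) (h1 : a (x, y, z) = .one) (hu : (u, v, w) ∈ V)
    (h12 : a (u, v, w) = .both) : w - v + f₂ - f₁ ≤ z - x := by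
  by_contra! hlt
  obtain ⟨-, -, hxz, hyz⟩ := S.domain.monotone ht
  have hwu := S.sub_le_of_one_of_both ht h1 hu h12
  have hxy := S.sub_price_one_le_sub_price_two ht h1
  have hw := S.sub_price_one_le_of_one ht h1 hu h12
  obtain ⟨η, ⟨x', y', hmem, hy', hxy', hor⟩, hη, hη'⟩ := ((S.domain.eventually_exists_mem_diagonal
    hu S.nonneg₂ (r := f₁) (by linarith) (by linarith) (by linarith) (by linarith)).and
    (Ioo_mem_nhdsGT (show 0 < (w - v + f₂ - f₁ - (z - x)) / 4 by linarith))).exists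
  have ha : a (x', y', w - v + y' - η) = .both := by
    cases ha : a (x', y', w - v + y' - η) with
    | empty => linarith [S.price_two_add_sub_le_of_empty hmem ha hu h12]
    | one => linarith [S.sub_price_one_le_sub_price_two hmem ha]
    | two => linarith [S.sub_le_of_two_of_both hmem ha hu h12]
    | both => rfl
  rcases hor with hle | rfl
  · linarith [S.sub_le_of_one_of_both ht h1 hmem ha]
  · linarith [S.sub_price_one_le_of_one ht h1 hmem ha]

theorem mem_upperBounds_lowerPrices_of_empty (S : IsSingleTaskPrice V a f₁ f₂)
    (ht : (x, y, z) ∈ V) (h0 : a (x, y, z) = .empty) : z ∈ upperBounds (lowerPrices V a f₁ f₂) := by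
  obtain ⟨-, -, hxz, hyz⟩ := S.domain.monotone ht
  rintro r ((rfl | rfl) | ⟨u, v, w, hu, h12, rfl | rfl | rfl⟩)
  · exact (S.le_of_empty₁ ht h0).trans hxz
  · exact (S.le_of_empty₂ ht h0).trans hyz
  · exact S.le_of_empty_of_both ht h0 hu h12
  · exact S.price_one_add_sub_le_of_empty ht h0 hu h12
  · exact S.price_two_add_sub_le_of_empty ht h0 hu h12

theorem mem_upperBounds_lowerPrices_of_one (S : IsSingleTaskPrice V a f₁ f₂)
    (ht : (x, y, z) ∈ V) (h1 : a (x, y, z) = .one) :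
    z - x + f₁ ∈ upperBounds (lowerPrices V a f₁ f₂) := by
  obtain ⟨-, -, hxz, hyz⟩ := S.domain.monotone ht
  rintro r ((rfl | rfl) | ⟨u, v, w, hu, h12, rfl | rfl | rfl⟩)
  · linarith
  · linarith [S.sub_price_one_le_sub_price_two ht h1]
  · linarith [S.sub_price_one_le_of_one ht h1 hu h12]
  · linarith [S.sub_le_of_one_of_both ht h1 hu h12]
  · linarith [S.sub_add_price_two_sub_price_one_le_of_one ht h1 hu h12]

theorem lowerPrices_preimage_swapBid (V : Set Bid) (a : Bid → Bundle) (f₁ f₂ : ℝ) :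
    lowerPrices (swapBid ⁻¹' V) (fun t => swapTasks (a (swapBid t))) f₂ f₁ =
      lowerPrices V a f₁ f₂ := by
  ext r
  simp only [lowerPrices, mem_union, mem_insert_iff, mem_singleton_iff, mem_ofPred_eq,
    swapTasks_eq_iff]
  refine or_congr or_comm ⟨?_, ?_⟩ <;>
  · rintro ⟨u, v, w, hu, h12, hr⟩
    exact ⟨v, u, w, hu, h12, hr.imp_right Or.symm⟩

theorem mem_upperBounds_lowerPrices_of_two (S : IsSingleTaskPrice V a f₁ f₂)
    (ht : (x, y, z) ∈ V) (h2 : a (x, y, z) = .two) :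
    z - y + f₂ ∈ upperBounds (lowerPrices V a f₁ f₂) := by
  rw [← lowerPrices_preimage_swapBid]
  exact S.swap.mem_upperBounds_lowerPrices_of_one (x := y) (y := x) ht (swapTasks_eq_iff.2 h2)

theorem isPrice_of_isLUB (S : IsSingleTaskPrice V a f₁ f₂) {f₁₂ : ℝ}
    (hf : IsLUB (lowerPrices V a f₁ f₂) f₁₂) : IsPrice V a (f₁, f₂, f₁₂) := by
  refine ⟨⟨S.nonneg₁, S.nonneg₂, hf.1 (Or.inl (Or.inl rfl)), hf.1 (Or.inl (Or.inr rfl))⟩, ?_⟩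
  rintro ⟨x, y, z⟩ ht α
  cases ha : a (x, y, z) with
  | empty =>
    have hx := S.le_of_empty₁ ht ha
    have hy := S.le_of_empty₂ ht ha
    have hz := hf.2 (S.mem_upperBounds_lowerPrices_of_empty ht ha)
    cases α <;> simp only [cost] <;> linarith
  | one =>
    have hx := S.le_of_one ht ha
    have hy := S.sub_price_one_le_sub_price_two ht ha
    have hz := hf.2 (S.mem_upperBounds_lowerPrices_of_one ht ha)
    cases α <;> simp only [cost] <;> linarith
  | two =>
    have hx := S.sub_price_two_le_sub_price_one ht ha
    have hy := S.le_of_two ht ha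
    have hz := hf.2 (S.mem_upperBounds_lowerPrices_of_two ht ha)
    cases α <;> simp only [cost] <;> linarith
  | both =>
    have hx : f₁ + z - x ≤ f₁₂ := hf.1 (Or.inr ⟨x, y, z, ht, ha, Or.inr (Or.inl rfl)⟩)
    have hy : f₂ + z - y ≤ f₁₂ := hf.1 (Or.inr ⟨x, y, z, ht, ha, Or.inr (Or.inr rfl)⟩)
    have hz : z ≤ f₁₂ := hf.1 (Or.inr ⟨x, y, z, ht, ha, Or.inl rfl⟩)
    cases α <;> simp only [cost] <;> linarith

end IsSingleTaskPrice

theorem exists_isSingleTaskPrice {V : Set Bid} {a : Bid → Bundle} (hV : IsExcessDomain V)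
    (hw : ∀ t ∈ V, ∀ t' ∈ V, cost t (a t) - cost t (a t') ≤ cost t' (a t) - cost t' (a t'))
    (h0 : ∃ t ∈ V, a t = .empty) : ∃ f₁ f₂, IsSingleTaskPrice V a f₁ f₂ := by
  have upper₁ {x y z} (ht : (x, y, z) ∈ V) (ha : a (x, y, z) = .empty) :
      x ∈ upperBounds (insert 0 {x | ∃ y z, (x, y, z) ∈ V ∧ a (x, y, z) = .one}) := by
    rintro r (rfl | ⟨y', z', ht', ha'⟩)
    · exact (hV.monotone ht).1
    · simpa [cost] using cost_sub_cost_le_of_wmon hw ht ht' ha ha'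
  have upper₂ {x y z} (ht : (x, y, z) ∈ V) (ha : a (x, y, z) = .empty) :
      y ∈ upperBounds (insert 0 {y | ∃ x z, (x, y, z) ∈ V ∧ a (x, y, z) = .two}) := by
    rintro r (rfl | ⟨x', z', ht', ha'⟩)
    · exact (hV.monotone ht).2.1
    · simpa [cost] using cost_sub_cost_le_of_wmon hw ht ht' ha ha'
  obtain ⟨⟨x₀, y₀, z₀⟩, ht₀, ha₀⟩ := h0
  obtain ⟨f₁, hf₁⟩ := Real.exists_isLUB (insert_nonempty _ _) ⟨x₀, upper₁ ht₀ ha₀⟩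
  obtain ⟨f₂, hf₂⟩ := Real.exists_isLUB (insert_nonempty _ _) ⟨y₀, upper₂ ht₀ ha₀⟩
  refine ⟨f₁, f₂, hV, hw, hf₁.1 (mem_insert _ _), hf₂.1 (mem_insert _ _),
    fun ht ha => hf₁.2 (upper₁ ht ha), fun ht ha => hf₂.2 (upper₂ ht ha),
    fun ht ha => hf₁.1 (Or.inr ⟨_, _, ht, ha⟩), fun ht ha => hf₂.1 (Or.inr ⟨_, _, ht, ha⟩),
    fun r hr hlt => ?_, fun r hr hlt => ?_⟩
  · obtain ⟨x, rfl | ⟨y, z, ht, ha⟩, hrx⟩ := (lt_isLUB_iff hf₁).1 hlt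
    · exact absurd hrx hr.not_gt
    · exact ⟨x, y, z, ht, ha, hrx⟩
  · obtain ⟨y, rfl | ⟨x, z, ht, ha⟩, hry⟩ := (lt_isLUB_iff hf₂).1 hlt
    · exact absurd hry hr.not_gt
    · exact ⟨x, y, z, ht, ha, hry⟩

theorem exists_isPrice {V : Set Bid} {a : Bid → Bundle} (hV : IsExcessDomain V)
    (hw : ∀ t ∈ V, ∀ t' ∈ V, cost t (a t) - cost t (a t') ≤ cost t' (a t) - cost t' (a t'))
    (h0 : ∃ t ∈ V, a t = .empty) : ∃ p, IsPrice V a p := by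
  obtain ⟨f₁, f₂, S⟩ := exists_isSingleTaskPrice hV hw h0
  obtain ⟨⟨x, y, z⟩, ht, ha⟩ := h0
  obtain ⟨f₁₂, hf⟩ := Real.exists_isLUB ⟨f₁, Or.inl (Or.inl rfl)⟩
    ⟨z, S.mem_upperBounds_lowerPrices_of_empty ht ha⟩
  exact ⟨_, S.isPrice_of_isLUB hf⟩

theorem IsExcessDomain.inter {V W : Set Bid} (hV : IsExcessDomain V) (hW : IsExcessDomain W) :
    IsExcessDomain (V ∩ W) where
  subset_monotoneVals := inter_subset_left.trans hV.subset_monotoneVals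
  exists_forall_mem := by
    rintro x y z ⟨hxV, hxW⟩
    obtain ⟨δ, hδ, hmem⟩ := hV.exists_forall_mem hxV
    obtain ⟨δ', hδ', hmem'⟩ := hW.exists_forall_mem hxW
    exact ⟨min δ δ', lt_min hδ hδ', fun x' y' z' hmono hle hlt =>
      ⟨hmem x' y' z' hmono hle (hlt.trans_le (by gcongr; exact min_le_left _ _)),
        hmem' x' y' z' hmono hle (hlt.trans_le (by gcongr; exact min_le_right _ _))⟩⟩

theorem isExcessDomain_monotoneVals : IsExcessDomain monotoneVals where
  subset_monotoneVals := Subset.rfl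
  exists_forall_mem _ := ⟨1, one_pos, fun _ _ _ hmono _ _ => hmono⟩

theorem isExcessDomain_submodVals : IsExcessDomain submodVals where
  subset_monotoneVals _ ht := ht.1
  exists_forall_mem := by
    intro x y z ⟨_, hle⟩
    refine ⟨1, one_pos, fun x' y' z' hmono hle' _ => ⟨hmono, ?_⟩⟩
    grind

theorem isExcessDomain_epsAddVals {ε : ℝ} (hε : 0 < ε) : IsExcessDomain (epsAddVals ε) where
  subset_monotoneVals _ ht := ht.1
  exists_forall_mem := by
    intro x y z ⟨_, hlt, hlt'⟩
    refine ⟨ε - max (x + y - z) 0, ?_, fun x' y' z' hmono hle hlt'' => ⟨hmono, ?_, ?_⟩⟩ <;> grind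

theorem mem_submodVals_inter_epsAddVals {ε x y z : ℝ} (hmono : (x, y, z) ∈ monotoneVals)
    (hle : z ≤ x + y) (hlt : x + y < z + ε) : (x, y, z) ∈ submodVals ∩ epsAddVals ε :=
  ⟨⟨hmono, hle⟩, hmono, by dsimp only; linarith, by dsimp only; linarith⟩

theorem mem_submodVals_inter_epsAddVals_of_add {ε x y : ℝ} (hε : 0 < ε) (hx : 0 ≤ x)
    (hy : 0 ≤ y) : (x, y, x + y) ∈ submodVals ∩ epsAddVals ε :=
  mem_submodVals_inter_epsAddVals ⟨hx, hy, by simpa, by simpa⟩ le_rfl (by linarith)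

theorem exists_mem_Ioo_add_mem_Ico {m₁ m₂ T ε : ℝ} (h₁ : m₁ < T) (h₂ : m₂ < T) (h₀ : 0 ≤ m₁)
    (hε : 0 < ε) (hsum : m₁ + m₂ < T + ε) :
    ∃ u ∈ Ioo m₁ T, ∃ v ∈ Ioo m₂ T, u + v ∈ Ico T (T + ε) := by
  obtain ⟨u, hu, hu'⟩ := exists_between (lt_min h₁ (show m₁ < T + ε - m₂ by linarith))
  obtain ⟨huT, huε⟩ := lt_min_iff.1 hu'
  obtain ⟨v, hv, hv'⟩ := exists_between (show max m₂ (T - u) < min T (T + ε - u) by grind)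
  exact ⟨u, ⟨hu, huT⟩, v, ⟨by grind, by grind⟩, by grind, by grind⟩

theorem exists_mem_Ioo_sub_mem_Ioo {p q p' q' l u : ℝ} (h : p < q) (h' : p' < q') (hlu : l < u)
    (h₁ : p - q' < u) (h₂ : l < q - p') :
    ∃ x ∈ Ioo p q, ∃ y ∈ Ioo p' q', x - y ∈ Ioo l u := by
  obtain ⟨d, hd, hd'⟩ := exists_between (show max l (p - q') < min u (q - p') by grind)
  obtain ⟨y, hy, hy'⟩ := exists_between (show max p' (p - d) < min q' (q - d) by grind)
  exact ⟨y + d, ⟨by grind, by grind⟩, y, ⟨by grind, by grind⟩, by grind, by grind⟩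

namespace IsPrice

variable {V : Set Bid} {a a' : Bid → Bundle} {f₁ f₂ f₁₂ g₁ g₂ g₁₂ ε : ℝ}

theorem eq_of_forall_lt {p t : Bid} (P : IsPrice V a p) (ht : t ∈ V) {α : Bundle}
    (hlt : ∀ β ≠ α, cost t α - cost p α < cost t β - cost p β) : a t = α := by
  by_contra hne
  exact (hlt _ hne).not_ge (P.2 t ht α)

theorem swap {p : Bid} (P : IsPrice V a p) :
    IsPrice (swapBid ⁻¹' V) (fun t => swapTasks (a (swapBid t))) (swapBid p) := by
  refine ⟨⟨P.1.2.1, P.1.1, P.1.2.2.2, P.1.2.2.1⟩, fun t ht α => ?_⟩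
  have h := P.2 _ ht (swapTasks α)
  simp only [cost_swapTasks] at h ⊢
  exact h

theorem exists_one_empty (hV : ∀ x y, 0 ≤ x → 0 ≤ y → (x, y, x + y) ∈ V)
    (P : IsPrice V a (f₁, f₂, f₁₂)) (P' : IsPrice V a' (g₁, g₂, g₁₂)) (hlt : g₁ < f₁) :
    ∃ t ∈ V, a t = .one ∧ a' t = .empty := by
  obtain ⟨-, -, hf₁₂, hf₁₂'⟩ := P.1
  obtain ⟨hg₁, -, hg₁₂, hg₁₂'⟩ := P'.1
  obtain ⟨u, hu, hu'⟩ := exists_between hlt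
  have ht := hV u (f₁₂ + g₁₂ + 1) (by grind) (by grind)
  refine ⟨_, ht, P.eq_of_forall_lt ht fun β hβ => ?_, P'.eq_of_forall_lt ht fun β hβ => ?_⟩ <;>
  cases β <;> grind [cost]

theorem exists_both_two (hV : ∀ x y, 0 ≤ x → 0 ≤ y → (x, y, x + y) ∈ V)
    (P : IsPrice V a (f₁, f₂, f₁₂)) (P' : IsPrice V a' (g₁, g₂, g₁₂)) (hf : f₁ < f₁₂)
    (hg : 0 < g₂) (hlt : g₁₂ - g₂ < f₁₂ - f₂) : ∃ t ∈ V, a t = .both ∧ a' t = .two := by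
  obtain ⟨-, hf₂, -, -⟩ := P.1
  obtain ⟨-, -, hg₁₂, hg₁₂'⟩ := P'.1
  obtain ⟨u, hu, hu'⟩ := exists_between hlt
  obtain ⟨v, hv, hv'⟩ := exists_between (show 0 < min (min (f₁₂ - f₁) g₂)
    (min (f₁₂ - f₂ - u) (u - (g₁₂ - g₂))) by grind)
  have ht := hV u v (by grind) hv.le
  refine ⟨_, ht, P.eq_of_forall_lt ht fun β hβ => ?_, P'.eq_of_forall_lt ht fun β hβ => ?_⟩ <;>
  cases β <;> grind [cost]

theorem exists_two_empty (hV : ∀ x y, 0 ≤ x → 0 ≤ y → (x, y, x + y) ∈ V)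
    (P : IsPrice V a (f₁, f₂, f₁₂)) (P' : IsPrice V a' (g₁, g₂, g₁₂)) (hlt : g₂ < f₂) :
    ∃ t ∈ V, a t = .two ∧ a' t = .empty := by
  obtain ⟨t, ht, ha, ha'⟩ := exists_one_empty
    (fun x y hx hy => by simpa [swapBid, add_comm] using hV y x hy hx) P.swap P'.swap hlt
  exact ⟨_, ht, swapTasks_eq_iff.1 ha, swapTasks_eq_iff.1 ha'⟩

theorem exists_both_one (hV : ∀ x y, 0 ≤ x → 0 ≤ y → (x, y, x + y) ∈ V)
    (P : IsPrice V a (f₁, f₂, f₁₂)) (P' : IsPrice V a' (g₁, g₂, g₁₂)) (hf : f₂ < f₁₂)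
    (hg : 0 < g₁) (hlt : g₁₂ - g₁ < f₁₂ - f₁) : ∃ t ∈ V, a t = .both ∧ a' t = .one := by
  obtain ⟨t, ht, ha, ha'⟩ := exists_both_two
    (fun x y hx hy => by simpa [swapBid, add_comm] using hV y x hy hx) P.swap P'.swap hf hg hlt
  exact ⟨_, ht, swapTasks_eq_iff.1 ha, swapTasks_eq_iff.1 ha'⟩

theorem exists_one_two (hV : ∀ x y, 0 ≤ x → 0 ≤ y → (x, y, x + y) ∈ V)
    (P : IsPrice V a (f₁, f₂, f₁₂)) (P' : IsPrice V a' (g₁, g₂, g₁₂)) (hlt : g₁ - g₂ < f₁ - f₂)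
    (h₁ : g₁₂ - g₂ < f₁) (h₂ : f₁₂ - f₁ < g₂) (h₁' : g₁₂ - g₂ - g₂ < f₁ - f₂)
    (h₂' : g₁ - g₂ < f₁ - (f₁₂ - f₁)) : ∃ t ∈ V, a t = .one ∧ a' t = .two := by
  obtain ⟨-, -, hf₁₂, -⟩ := P.1
  obtain ⟨-, -, -, hg₁₂'⟩ := P'.1
  obtain ⟨u, hu, v, hv, huv, huv'⟩ := exists_mem_Ioo_sub_mem_Ioo h₁ h₂ hlt h₁' h₂'
  have ht := hV u v (by grind) (by grind)
  refine ⟨_, ht, P.eq_of_forall_lt ht fun β hβ => ?_, P'.eq_of_forall_lt ht fun β hβ => ?_⟩ <;>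
  cases β <;> grind [cost]

theorem exists_both_empty (hε : 0 < ε) (hV : submodVals ∩ epsAddVals ε ⊆ V)
    (P : IsPrice V a (f₁, f₂, f₁₂)) (P' : IsPrice V a' (g₁, g₂, g₁₂)) (hlt : g₁₂ < f₁₂)
    (hf₁ : f₁ < f₁₂) (hf₂ : f₂ < f₁₂) (hgf : g₁ + f₂ < f₁₂ + ε) (hgf' : g₂ + f₁ < f₁₂ + ε)
    (hf : f₁ + f₂ < f₁₂ + ε) (hg : g₁ + g₂ < g₁₂ + ε) :
    ∃ t ∈ V, a t = .both ∧ a' t = .empty := by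
  obtain ⟨hg₁, -, hg₁₂, hg₁₂'⟩ := P'.1
  obtain ⟨T, hT, hT'⟩ := exists_between hlt
  obtain ⟨u, hu, v, hv, huv, huv'⟩ := exists_mem_Ioo_add_mem_Ico (m₁ := max g₁ (T - (f₁₂ - f₁)))
    (m₂ := max g₂ (T - (f₁₂ - f₂))) (T := T) (by grind) (by grind) (by grind) hε (by grind)
  have ht : (u, v, T) ∈ V := hV (mem_submodVals_inter_epsAddVals
    ⟨by grind, by grind, hu.2.le, hv.2.le⟩ huv huv')
  refine ⟨_, ht, P.eq_of_forall_lt ht fun β hβ => ?_, P'.eq_of_forall_lt ht fun β hβ => ?_⟩ <;>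
  cases β <;> grind [cost]

end IsPrice

theorem mem_boundedAddVals {B x y : ℝ} (hx : x ∈ Ioo 0 B) (hy : y ∈ Ioo 0 B) :
    (x, y, x + y) ∈ boundedAddVals B :=
  ⟨⟨hx.1.le, hx.2⟩, ⟨hy.1.le, hy.2⟩, rfl⟩

/-- The prices of the `t`-player, as functions of the positive additive bid `(x, y)` of the
`s`-player. -/
def HasPrices (B : ℝ) (V : Set Bid) (A : Allocation) (f₁ f₂ f₁₂ : ℝ → ℝ → ℝ) : Prop :=
  ∀ x ∈ Ioo 0 B, ∀ y ∈ Ioo 0 B,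
    IsPrice V (fun t => A t (x, y, x + y)) (f₁ x y, f₂ x y, f₁₂ x y)

theorem exists_hasPrices {B : ℝ} {V : Set Bid} (hV : IsExcessDomain V) {A : Allocation}
    (hA : ∀ s ∈ boundedAddVals B, ∀ t ∈ V, ∀ t' ∈ V,
      cost t (A t s) - cost t (A t' s) ≤ cost t' (A t s) - cost t' (A t' s))
    (hempty : ∀ s ∈ boundedAddVals B, ∃ t ∈ V, A t s = .empty) :
    ∃ f₁ f₂ f₁₂, HasPrices B V A f₁ f₂ f₁₂ := by
  have hex : ∀ x ∈ Ioo 0 B, ∀ y ∈ Ioo 0 B, ∃ p, IsPrice V (fun t => A t (x, y, x + y)) p :=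
    fun x hx y hy => have hs := mem_boundedAddVals hx hy; exists_isPrice hV (hA _ hs) (hempty _ hs)
  choose! p hp using hex
  exact ⟨fun x y => (p x y).1, fun x y => (p x y).2.1, fun x y => (p x y).2.2, hp⟩

theorem cost_compl_sub_le {S V : Set Bid} {A : Allocation}
    (hA : ∀ t ∈ V, ∀ s ∈ S, ∀ s' ∈ S, cost s (A t s).compl - cost s (A t s').compl ≤
      cost s' (A t s).compl - cost s' (A t s').compl)
    {s s' : Bid} (hs : s ∈ S) (hs' : s' ∈ S) {α β : Bundle}
    (h : ∃ t ∈ V, A t s = α ∧ A t s' = β) :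
    cost s α.compl - cost s β.compl ≤ cost s' α.compl - cost s' β.compl := by
  obtain ⟨t, ht, rfl, rfl⟩ := h
  exact hA t ht s hs s' hs'

theorem HasPrices.criticalValues {B ε : ℝ} (hB : 0 < B) (hε : 0 < ε) {V : Set Bid}
    (hV : submodVals ∩ epsAddVals ε ⊆ V) {A : Allocation}
    (hA : ∀ t ∈ V, ∀ s ∈ boundedAddVals B, ∀ s' ∈ boundedAddVals B,
      cost s (A t s).compl - cost s (A t s').compl ≤
        cost s' (A t s).compl - cost s' (A t s').compl)
    {f₁ f₂ f₁₂ : ℝ → ℝ → ℝ} (hp : HasPrices B V A f₁ f₂ f₁₂) :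
    CriticalValues B ε f₁ f₂ f₁₂ := by
  have add_mem (x y : ℝ) (hx : 0 ≤ x) (hy : 0 ≤ y) : (x, y, x + y) ∈ V :=
    hV (mem_submodVals_inter_epsAddVals_of_add hε hx hy)
  refine ⟨hB, hε, fun x hx y hy => (hp x hx y hy).1.1, fun x hx y hy => (hp x hx y hy).1.2.1,
    fun x hx y hy => (hp x hx y hy).1.2.2.1, fun x hx y hy => (hp x hx y hy).1.2.2.2,
    ?_, ?_, ?_, ?_, ?_, ?_⟩ <;>
  intro x hx y hy x' hx' y' hy' hlt <;>
  have P := hp x hx y hy <;>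
  have P' := hp x' hx' y' hy' <;>
  have hle {α β : Bundle} := cost_compl_sub_le (α := α) (β := β) hA
    (mem_boundedAddVals hx hy) (mem_boundedAddVals hx' hy')
  · by_contra! hcon
    have := hle (P.exists_one_empty add_mem P' hcon)
    grind [cost, Bundle.compl]
  · by_contra! hcon
    have := hle (P.exists_two_empty add_mem P' hcon)
    grind [cost, Bundle.compl]
  · intro hf hg
    by_contra! hcon
    have := hle (P.exists_both_two add_mem P' hf hg hcon)
    grind [cost, Bundle.compl]
  · intro hf hg
    by_contra! hcon
    have := hle (P.exists_both_one add_mem P' hf hg hcon)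
    grind [cost, Bundle.compl]
  · intro hf₁ hf₂ hgf hgf' hf hg
    by_contra! hcon
    have := hle (P.exists_both_empty hε hV P' hcon hf₁ hf₂ hgf hgf' hf hg)
    grind [cost, Bundle.compl]
  · intro h₂ h₁ h₁' h₂'
    by_contra! hcon
    have := hle (P.exists_one_two add_mem P' hcon h₁ h₂ h₁' h₂')
    grind [cost, Bundle.compl]

theorem CriticalValues.mono₁₂_of_eq_zero {B ε : ℝ} {f₁ f₂ f₁₂ : ℝ → ℝ → ℝ}
    (h : CriticalValues B ε f₁ f₂ f₁₂) {x y x' y' : ℝ} (hx : x ∈ Ioo 0 B) (hy : y ∈ Ioo 0 B)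
    (hx' : x' ∈ Ioo 0 B) (hy' : y' ∈ Ioo 0 B) (hlt : x + y < x' + y')
    (h₀ : f₁ x y = 0 ∧ f₂ x y = 0) (h₀' : f₁ x' y' = 0 ∧ f₂ x' y' = 0) :
    f₁₂ x y ≤ f₁₂ x' y' := by
  have hε := h.ε_pos
  have hle := h.le₁ x hx y hy
  have hle' := h.le₁ x' hx' y' hy'
  rcases hle.eq_or_lt with heq | hpos
  · linarith
  · exact h.mono₁₂ x hx y hy x' hx' y' hy' hlt hpos (by linarith) (by linarith) (by linarith)
      (by linarith) (by linarith)

/-- The additive constants of an affine minimizer: `γ_α = -c_α`, and `γ_∅ = 0`. -/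
noncomputable def affineConstants (c : Bid) (α : Bundle) : EReal :=
  ((-cost c α : ℝ) : EReal)

theorem admissibleConstants_affineConstants (c : Bid) :
    AdmissibleConstants (affineConstants c) :=
  ⟨EReal.coe_ne_top _, fun _ => EReal.coe_ne_bot _⟩

theorem affineCost_affineConstants (μt μs : ℝ) (c t s : Bid) (α : Bundle) :
    affineCost μt μs (affineConstants c) t s α =
      ((μt * cost t α + μs * cost s α.compl - cost c α : ℝ) : EReal) := by
  rw [affineCost, affineConstants, ← EReal.coe_add, ← sub_eq_add_neg]

namespace IsPrice

variable {V : Set Bid} {a : Bid → Bundle} {A : Allocation} {p s t : Bid} {α : Bundle}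

theorem minimizesAffineCost (P : IsPrice V a p) (ht : t ∈ V) {l x y : ℝ} {c : Bid}
    (hle : ∀ β, l * cost (x, y, x + y) β + cost c β ≤ cost p β)
    (heq : l * cost (x, y, x + y) (a t) + cost c (a t) = cost p (a t)) :
    MinimizesAffineCost 1 l (affineConstants c) t (x, y, x + y) (a t) := by
  have cost_compl (β : Bundle) : cost (x, y, x + y) β.compl = x + y - cost (x, y, x + y) β := by
    cases β <;> simp [cost, Bundle.compl]
  intro β
  rw [affineCost_affineConstants, affineCost_affineConstants, EReal.coe_le_coe_iff, cost_compl,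
    cost_compl]
  linarith [P.2 t ht β, hle β]

theorem minimizesAffineCost_of_isAffineAt {f₁ f₂ f₁₂ : ℝ → ℝ → ℝ} {l c₁ c₂ c₁₂ x y : ℝ}
    (P : IsPrice V a (f₁ x y, f₂ x y, f₁₂ x y)) (h : IsAffineAt l c₁ c₂ c₁₂ f₁ f₂ f₁₂ x y)
    (ht : t ∈ positivePart V) :
    MinimizesAffineCost 1 l (affineConstants (c₁, c₂, c₁₂)) t (x, y, x + y) (a t) := by
  obtain ⟨htV, ht₁, ht₂, ht₁₂, ht₁₂'⟩ := ht
  obtain ⟨h₁, h₂, h₁₂⟩ := h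
  refine P.minimizesAffineCost htV (fun β => ?_) ?_
  · cases β <;> simp only [cost] <;> grind
  · have hempty := P.2 t htV .empty
    have hone := P.2 t htV .one
    have htwo := P.2 t htV .two
    cases hat : a t <;> simp only [hat, cost] at hempty hone htwo ⊢ <;> grind

theorem eq_empty_or_eq_both (P : IsPrice V a p) (h₁ : p.1 = 0) (h₂ : p.2.1 = 0)
    (ht : t ∈ positivePart V) : a t = .empty ∨ a t = .both := by
  obtain ⟨htV, ht₁, ht₂, -⟩ := ht
  have hempty := P.2 t htV .empty
  cases hat : a t <;> simp only [hat, cost] at hempty <;> grind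

theorem eq_empty_or_eq_two (P : IsPrice V a p) (h₁ : p.1 = 0) (h₁₂ : p.2.2 = p.2.1)
    (ht : t ∈ positivePart V) : a t = .empty ∨ a t = .two := by
  obtain ⟨htV, ht₁, -, -, ht₂⟩ := ht
  have hempty := P.2 t htV .empty
  have htwo := P.2 t htV .two
  cases hat : a t <;> simp only [hat, cost] at hempty htwo <;> grind

theorem eq_empty_or_eq_one (P : IsPrice V a p) (h₂ : p.2.1 = 0) (h₁₂ : p.2.2 = p.1)
    (ht : t ∈ positivePart V) : a t = .empty ∨ a t = .one := by
  obtain ⟨htV, -, ht₂, ht₁, -⟩ := ht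
  have hempty := P.2 t htV .empty
  have hone := P.2 t htV .one
  cases hat : a t <;> simp only [hat, cost] at hempty hone <;> grind

theorem hasCriticalValue (P : IsPrice V (fun t => A t s) p)
    (hα : ∀ t ∈ positivePart V, A t s = .empty ∨ A t s = α) :
    HasCriticalValue (positivePart V) A α 1 s (cost p α) := by
  have cost_empty (x : Bid) : cost x .empty = 0 := rfl
  refine fun t ht => ⟨hα t ht, fun hlt => (hα t ht).resolve_right fun hat => ?_,
    fun hlt => (hα t ht).resolve_left fun hat => ?_⟩
  · have := P.2 t ht.1 .empty
    simp only [hat, cost_empty] at this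
    linarith
  · have := P.2 t ht.1 α
    simp only [hat, cost_empty] at this
    linarith

theorem cost_nonneg (P : IsPrice V a p) (α : Bundle) : 0 ≤ cost p α := by
  obtain ⟨h₁, h₂, h₁₂, -⟩ := P.1
  cases α
  · exact le_rfl
  · exact h₁
  · exact h₂
  · exact h₁.trans h₁₂

end IsPrice

theorem mem_positivePart_boundedAddVals {B : ℝ} {s : Bid}
    (hs : s ∈ positivePart (boundedAddVals B)) :
    ∃ x ∈ Ioo 0 B, ∃ y ∈ Ioo 0 B, s = (x, y, x + y) := by
  obtain ⟨x, y, z⟩ := s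
  obtain ⟨⟨hx, hy, rfl : z = x + y⟩, hx₀, hy₀, -⟩ := hs
  exact ⟨x, ⟨hx₀, hx.2⟩, y, ⟨hy₀, hy.2⟩, rfl⟩

theorem isOneDimensional_of_isPrice {V S : Set Bid} {A : Allocation} {p : Bid → Bid}
    (hp : ∀ s ∈ S, IsPrice V (fun t => A t s) (p s)) {α : Bundle} (hα : α ≠ .empty)
    (hmono : ∀ s ∈ S, ∀ s' ∈ S, cost s α < cost s' α → cost (p s) α ≤ cost (p s') α)
    (honly : ∀ s ∈ S, ∀ t ∈ positivePart V, A t s = .empty ∨ A t s = α) :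
    IsOneDimensional (positivePart V) S A := by
  have hex : ∀ z ∈ (fun s => cost s α) '' S, ∃ s ∈ S, cost s α = z := fun _ hz => hz
  choose! σ hσS hσ using hex
  refine ⟨α, fun z => cost (p (σ z)) α, hα, fun z hz z' hz' hle => ?_,
    fun z hz => (hp _ (hσS z hz)).cost_nonneg α, fun s hs => ⟨cost (p s) α,
      ⟨fun z hz hlt => ?_, fun z hz hlt => ?_⟩, (hp s hs).hasCriticalValue (honly s hs)⟩⟩
  · rcases hle.eq_or_lt with rfl | hlt
    · exact le_rfl
    · exact hmono _ (hσS z hz) _ (hσS z' hz') (by rwa [hσ z hz, hσ z' hz'])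
  · exact hmono _ (hσS z hz) _ hs (by rwa [hσ z hz])
  · exact hmono _ hs _ (hσS z hz) (by rwa [hσ z hz])

theorem exists_monotone_betweenLimits {ι : Type*} {S : Set ι} {r F : ι → ℝ} {R M : ℝ}
    (hM : 0 ≤ M) (hr : ∀ s ∈ S, r s ≤ R) (hF : ∀ s ∈ S, F s ∈ Icc 0 M)
    (hmono : ∀ s ∈ S, ∀ s' ∈ S, r s < r s' → F s ≤ F s') :
    ∃ ξ : ℝ → ℝ, Monotone ξ ∧ (∀ z, 0 ≤ ξ z) ∧ ξ R = M ∧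
      ∀ s ∈ S, BetweenLimits ξ univ (r s) (F s) := by
  let below (z : ℝ) : Set ℝ := insert 0 (F '' {s | s ∈ S ∧ r s ≤ z})
  have below_nonempty (z : ℝ) : (below z).Nonempty := insert_nonempty _ _
  have below_subset (z : ℝ) : below z ⊆ Icc 0 M :=
    insert_subset ⟨le_rfl, hM⟩ (image_subset_iff.2 fun s hs => hF s hs.1)
  have bddAbove (z : ℝ) : BddAbove (below z) := bddAbove_Icc.mono (below_subset z)
  have sSup_mem (z : ℝ) : sSup (below z) ∈ Icc 0 M :=
    ⟨le_csSup (bddAbove z) (mem_insert _ _),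
      csSup_le (below_nonempty z) fun w hw => (below_subset z hw).2⟩
  refine ⟨fun z => if z < R then sSup (below z) else M, fun z z' hle => ?_, fun z => ?_,
    if_neg (lt_irrefl R), fun s hs => ⟨fun z _ hz => ?_, fun z _ hz => ?_⟩⟩ <;> dsimp only
  · split_ifs with hz hz'
    · refine csSup_le_csSup (bddAbove z') (below_nonempty z) (insert_subset_insert ?_)
      exact image_mono fun s hs => ⟨hs.1, hs.2.trans hle⟩
    · exact (sSup_mem z).2
    · linarith
    · exact le_rfl
  · split_ifs
    exacts [(sSup_mem z).1, hM]
  · rw [if_pos (hz.trans_le (hr s hs))]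
    refine csSup_le (below_nonempty z) (forall_mem_insert.2 ⟨(hF s hs).1, ?_⟩)
    exact forall_mem_image.2 fun s' hs' => hmono s' hs'.1 s hs (hs'.2.trans_lt hz)
  · split_ifs
    · exact le_csSup (bddAbove z) (mem_insert_of_mem _ (mem_image_of_mem F ⟨hs, hz.le⟩))
    · exact (hF s hs).2

theorem BetweenLimits.mono {ξ : ℝ → ℝ} {I J : Set ℝ} {x c : ℝ} (h : BetweenLimits ξ J x c)
    (hIJ : I ⊆ J) : BetweenLimits ξ I x c :=
  ⟨fun y hy => h.1 y (hIJ hy), fun y hy => h.2 y (hIJ hy)⟩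

namespace HasPrices

variable {B ε : ℝ} {V : Set Bid} {A : Allocation} {f₁ f₂ f₁₂ : ℝ → ℝ → ℝ}

theorem isAffineMinimizer_or_isConstantMechanism (hp : HasPrices B V A f₁ f₂ f₁₂)
    (hform : IsAffineForm B f₁ f₂ f₁₂) :
    IsAffineMinimizer (positivePart V) (positivePart (boundedAddVals B)) A ∨
      IsConstantMechanism (positivePart V) (positivePart (boundedAddVals B)) A := by
  obtain ⟨l, c₁, c₂, c₁₂, hl, haff⟩ := hform
  have hmin : ∀ t ∈ positivePart V, ∀ s ∈ positivePart (boundedAddVals B),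
      MinimizesAffineCost 1 l (affineConstants (c₁, c₂, c₁₂)) t s (A t s) := by
    intro t ht s hs
    obtain ⟨x, hx, y, hy, rfl⟩ := mem_positivePart_boundedAddVals hs
    exact (hp x hx y hy).minimizesAffineCost_of_isAffineAt (haff x hx y hy) ht
  rcases hl.eq_or_lt with rfl | hl
  · exact Or.inr ⟨1, _, one_pos, admissibleConstants_affineConstants _, hmin⟩
  · exact Or.inl ⟨1, l, _, one_pos, hl, admissibleConstants_affineConstants _, hmin⟩

theorem isAffineMinimizerWithTail (hp : HasPrices B V A f₁ f₂ f₁₂)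
    (h : CriticalValues B ε f₁ f₂ f₁₂) (hform : IsTailForm B f₁ f₂ f₁₂) :
    IsAffineMinimizerWithTail (positivePart V) (positivePart (boundedAddVals B)) A := by
  obtain ⟨l, c₁, c₂, c₁₂, D, hl, hD, hc₁₂, hc, hform⟩ := hform
  have hmin : min (affineConstants (c₁, c₂, c₁₂) .one) (affineConstants (c₁, c₂, c₁₂) .two) =
      ((l * D : ℝ) : EReal) := by
    rw [← neg_eq_iff_eq_neg.2 hc, ← min_neg_neg, EReal.coe_strictMono.monotone.map_min]
    rfl
  obtain ⟨ξ, hξmono, hξ₀, hξD, hξ⟩ := exists_monotone_betweenLimits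
    (S := {z : ℝ × ℝ | z.1 ∈ Ioo 0 B ∧ z.2 ∈ Ioo 0 B ∧ z.1 + z.2 ≤ D})
    (r := fun z => l * (z.1 + z.2)) (F := fun z => f₁₂ z.1 z.2) hc₁₂
    (fun z hz => mul_le_mul_of_nonneg_left hz.2.2 hl.le)
    (fun z ⟨hx, hy, hle⟩ => ⟨(hp _ hx _ hy).cost_nonneg .both, ((hform _ hx _ hy).2 hle).2.2⟩)
    (fun z ⟨hx, hy, hle⟩ z' ⟨hx', hy', hle'⟩ hlt =>
      have h₀ := (hform _ hx _ hy).2 hle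
      have h₀' := (hform _ hx' _ hy').2 hle'
      h.mono₁₂_of_eq_zero hx hy hx' hy' (lt_of_mul_lt_mul_left hlt hl.le)
        ⟨h₀.1, h₀.2.1⟩ ⟨h₀'.1, h₀'.2.1⟩)
  refine ⟨1, l, affineConstants (c₁, c₂, c₁₂), l * D, ξ, one_pos, hl,
    admissibleConstants_affineConstants _, mul_pos hl hD, ?_, hξmono.monotoneOn _,
    fun z _ => hξ₀ z, ?_, fun s hs hlt t ht => ?_, fun s hs hle => ?_⟩
  · rw [hmin]
    simp [affineConstants, cost]
  · rw [hmin, hξD, affineConstants, ← EReal.coe_sub, sub_neg_eq_add]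
    rfl
  · obtain ⟨x, hx, y, hy, rfl⟩ := mem_positivePart_boundedAddVals hs
    have haff := (hform x hx y hy).1 (lt_of_mul_lt_mul_left hlt hl.le)
    exact (hp x hx y hy).minimizesAffineCost_of_isAffineAt haff ht
  · obtain ⟨x, hx, y, hy, rfl⟩ := mem_positivePart_boundedAddVals hs
    have hxy : x + y ≤ D := le_of_mul_le_mul_left hle hl
    obtain ⟨h₁, h₂, h₁₂⟩ := (hform x hx y hy).2 hxy
    refine ⟨f₁₂ x y, (hξ (x, y) ⟨hx, hy, hxy⟩).mono (subset_univ _), hξD ▸ h₁₂, ?_⟩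
    exact (hp x hx y hy).hasCriticalValue fun t ht => (hp x hx y hy).eq_empty_or_eq_both h₁ h₂ ht

theorem isOneDimensional (hp : HasPrices B V A f₁ f₂ f₁₂) {α : Bundle} (hα : α ≠ .empty)
    (hmono : ∀ x ∈ Ioo 0 B, ∀ y ∈ Ioo 0 B, ∀ x' ∈ Ioo 0 B, ∀ y' ∈ Ioo 0 B,
      cost (x, y, x + y) α < cost (x', y', x' + y') α →
        cost (f₁ x y, f₂ x y, f₁₂ x y) α ≤ cost (f₁ x' y', f₂ x' y', f₁₂ x' y') α)
    (honly : ∀ x ∈ Ioo 0 B, ∀ y ∈ Ioo 0 B, ∀ t ∈ positivePart V,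
      A t (x, y, x + y) = .empty ∨ A t (x, y, x + y) = α) :
    IsOneDimensional (positivePart V) (positivePart (boundedAddVals B)) A := by
  refine isOneDimensional_of_isPrice
    (p := fun s => (f₁ s.1 s.2.1, f₂ s.1 s.2.1, f₁₂ s.1 s.2.1)) ?_ hα ?_ ?_
  · intro s hs
    obtain ⟨x, hx, y, hy, rfl⟩ := mem_positivePart_boundedAddVals hs
    exact hp x hx y hy
  · intro s hs s' hs'
    obtain ⟨x, hx, y, hy, rfl⟩ := mem_positivePart_boundedAddVals hs
    obtain ⟨x', hx', y', hy', rfl⟩ := mem_positivePart_boundedAddVals hs'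
    exact hmono x hx y hy x' hx' y' hy'
  · intro s hs
    obtain ⟨x, hx, y, hy, rfl⟩ := mem_positivePart_boundedAddVals hs
    exact honly x hx y hy

theorem isOneDimensional_of_isOneDimensionalForm (hp : HasPrices B V A f₁ f₂ f₁₂)
    (h : CriticalValues B ε f₁ f₂ f₁₂) (hform : IsOneDimensionalForm B f₁ f₂ f₁₂) :
    IsOneDimensional (positivePart V) (positivePart (boundedAddVals B)) A := by
  rcases hform with hform | hform | hform
  · exact hp.isOneDimensional (α := .both) nofun
      (fun x hx y hy x' hx' y' hy' hlt => h.mono₁₂_of_eq_zero hx hy hx' hy' hlt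
        (hform x hx y hy) (hform x' hx' y' hy'))
      fun x hx y hy t => (hp x hx y hy).eq_empty_or_eq_both (hform x hx y hy).1 (hform x hx y hy).2
  · exact hp.isOneDimensional (α := .two) nofun h.mono₂
      fun x hx y hy t => (hp x hx y hy).eq_empty_or_eq_two (hform x hx y hy).1 (hform x hx y hy).2
  · exact hp.isOneDimensional (α := .one) nofun h.mono₁
      fun x hx y hy t => (hp x hx y hy).eq_empty_or_eq_one (hform x hx y hy).1 (hform x hx y hy).2

end HasPrices

theorem isExcessDomain_of_eq_or {ε : ℝ} (hε : 0 < ε) {V : Set Bid}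
    (hV : V = monotoneVals ∨ V = submodVals ∨ V = epsAddVals ε ∨ V = submodVals ∩ epsAddVals ε) :
    IsExcessDomain V := by
  rcases hV with rfl | rfl | rfl | rfl
  · exact isExcessDomain_monotoneVals
  · exact isExcessDomain_submodVals
  · exact isExcessDomain_epsAddVals hε
  · exact isExcessDomain_submodVals.inter (isExcessDomain_epsAddVals hε)

theorem submodVals_inter_epsAddVals_subset_of_eq_or {ε : ℝ} {V : Set Bid}
    (hV : V = monotoneVals ∨ V = submodVals ∨ V = epsAddVals ε ∨ V = submodVals ∩ epsAddVals ε) :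
    submodVals ∩ epsAddVals ε ⊆ V := by
  rcases hV with rfl | rfl | rfl | rfl
  · exact fun t ht => ht.1.1
  · exact inter_subset_left
  · exact inter_subset_right
  · exact Subset.rfl

theorem mainTheorem2_general {B ε : ℝ} (hB : 0 < B) (hε : 0 < ε) {V : Set Bid}
    (hV : IsExcessDomain V) (hsub : submodVals ∩ epsAddVals ε ⊆ V) {A : Allocation}
    (hA : IsWMON V (boundedAddVals B) A)
    (hempty : ∀ s ∈ boundedAddVals B, ∃ t ∈ V, A t s = .empty) :
    IsRelaxedAffineMinimizer (positivePart V) (positivePart (boundedAddVals B)) A ∨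
    IsOneDimensional (positivePart V) (positivePart (boundedAddVals B)) A ∨
    IsConstantMechanism (positivePart V) (positivePart (boundedAddVals B)) A := by
  obtain ⟨f₁, f₂, f₁₂, hp⟩ := exists_hasPrices hV hA.1 hempty
  have h : CriticalValues B ε f₁ f₂ f₁₂ := hp.criticalValues hB hε hsub hA.2
  rcases h.isClassified with haffine | htail | hone
  · rcases hp.isAffineMinimizer_or_isConstantMechanism haffine with hmin | hconst
    · exact Or.inl (Or.inl hmin)
    · exact Or.inr (Or.inr hconst)
  · exact Or.inl (Or.inr (hp.isAffineMinimizerWithTail h htail))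
  · exact Or.inr (Or.inl (hp.isOneDimensional_of_isOneDimensionalForm h hone))

theorem exists_eq_empty_of_region_nonempty {V : Set Bid} {A : Allocation} {s : Bid}
    (h : (region V A .empty s).Nonempty) : ∃ t ∈ V, A t s = .empty :=
  have ⟨t, ht, hev⟩ := h
  ⟨t, ht, hev.self_of_nhdsWithin ht⟩

theorem mainTheorem2 (B ε : ℝ) (hB : 0 < B) (hε : 0 < ε) (V : Set Bid)
    (hV : V = monotoneVals ∨ V = submodVals ∨ V = epsAddVals ε ∨ V = submodVals ∩ epsAddVals ε)
    (A : Allocation) (hA : IsWMON V (boundedAddVals B) A)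
    (hR : ∀ s ∈ boundedAddVals B, (region V A .empty s).Nonempty) :
    IsRelaxedAffineMinimizer (positivePart V) (positivePart (boundedAddVals B)) A ∨
    IsOneDimensional (positivePart V) (positivePart (boundedAddVals B)) A ∨
    IsConstantMechanism (positivePart V) (positivePart (boundedAddVals B)) A := by
  exact mainTheorem2_general hB hε (isExcessDomain_of_eq_or hε hV)
    (submodVals_inter_epsAddVals_subset_of_eq_or hV) hA fun s hs =>
      exists_eq_empty_of_region_nonempty (hR s hs)
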